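/- Let $N\ge 2$ be an integer and let $F:\mathbb R^N\to[0,\infty)$ be convex, of class $C^2$ on $\mathbb R^N\setminus\{0\}$, with $F(t\xi)=|t|F(\xi)$ for all $t\in\mathbb R$, $\xi\in\mathbb R^N$, and $F(\xi)>0$ for $\xi\ne 0$. Assume that there are constants $0<a\le b<\infty$ and $0<\lambda\le\Lambda<\infty$ with $a|\xi|\le F(\xi)\le b|\xi|$ for all $\xi\in\mathbb R^N$ and $$\lambda^2|V|^2\le \sum_{i,j}F_{\xi_i\xi_j}(\xi)V_iV_j\le\Lambda|V|^2\qquad\text{whenever } |\xi|=1,\ \langle V,\xi\rangle=0 .$$ Let $F^0(x)=\sup\{\langle x,\xi\rangle : F(\xi)<1\}$ and $Qu=\sum_{i}\partial_{x_i}\big(F(\nabla u)F_{\xi_i}(\nabla u)\big)$. A function $u\in H^1_{loc}(\mathbb R^N)$, with weak gradient $\nabla u$, is a *weak solution* of $-Qu=f(x,u)$ on $\mathbb R^N$ if $f(x,u)\in L^1_{loc}(\mathbb R^N)$ and $$\int_{\mathbb R^N}F(\nabla u)F_\xi(\nabla u)\cdot\nabla\phi\,dx=\int_{\mathbb R^N}f(x,u)\phi\,dx\qquad\text{for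 all }\phi\in C_c^\infty(\mathbb R^N),$$ where $F(\xi)F_\xi(\xi)$ is read as $0$ at $\xi=0$. It is *stable* if for all $\phi\in C_c^\infty(\mathbb R^N)$ $$\int_{\mathbb R^N}\Big(\sum_{i,j}\big(F_{\xi_i}F_{\xi_j}+F\,F_{\xi_i\xi_j}\big)(\nabla u)\,\phi_{x_i}\phi_{x_j}-\partial_uf(x,u)\,\phi^2\Big)dx\ge 0,$$ where at points with $\nabla u=0$ the quadratic form $\sum_{i,j}(F_{\xi_i}F_{\xi_j}+F F_{\xi_i\xi_j})(0)V_iV_j$ is read as $\limsup_{\eta\to0,\ \eta\ne0}\sum_{i,j}(F_{\xi_i}F_{\xi_j}+F F_{\xi_i\xi_j})(\eta)V_iV_j$. **Theorem.** Let $\alpha>-2$ and $2\le N<10+4\alpha$. Then the equation $$-Qu=(F^0(x))^\alpha e^u\qquad\text{in }\mathbb R^N$$ has no weak stable solution. -/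

import Mathlib

open MeasureTheory Filter Topology
open scoped ContDiff

/-- `ℝ^N` with its Euclidean structure. -/
abbrev Euc (N : ℕ) : Type := EuclideanSpace ℝ (Fin N)

/-- The second derivative `∑ i j, F_{ξ_i ξ_j}(ξ) V_i V_j` of `F` at `ξ` in the direction `V`. -/
noncomputable def hessForm {N : ℕ} (F : Euc N → ℝ) (ξ V : Euc N) : ℝ :=
  fderiv ℝ (fderiv ℝ F) ξ V V

/-- The standing assumptions on the anisotropy `F : ℝ^N → [0, ∞)`. The two-sided bound on the
Hessian is required at unit vectors `ξ`: the second derivatives of a 1-homogeneous function are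
homogeneous of degree `-1`, so this determines the bound at all `ξ ≠ 0`. -/
structure IsFinslerNorm {N : ℕ} (F : Euc N → ℝ) : Prop where
  nonneg : ∀ ξ, 0 ≤ F ξ
  convex : ConvexOn ℝ Set.univ F
  contDiff : ContDiffOn ℝ 2 F {0}ᶜ
  homogeneous : ∀ (t : ℝ) (ξ : Euc N), F (t • ξ) = |t| * F ξ
  pos : ∀ ξ, ξ ≠ 0 → 0 < F ξ
  comparable : ∃ a b : ℝ, 0 < a ∧ a ≤ b ∧ ∀ ξ, a * ‖ξ‖ ≤ F ξ ∧ F ξ ≤ b * ‖ξ‖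
  elliptic : ∃ l L : ℝ, 0 < l ∧ l ≤ L ∧ ∀ ξ V : Euc N, ‖ξ‖ = 1 → inner ℝ V ξ = 0 →
    l ^ 2 * ‖V‖ ^ 2 ≤ hessForm F ξ V ∧ hessForm F ξ V ≤ L * ‖V‖ ^ 2

/-- The support function `F⁰(x) = sup {⟨x, ξ⟩ : F(ξ) < 1}` of `{F < 1}`. -/
noncomputable def supportFn {N : ℕ} (F : Euc N → ℝ) (x : Euc N) : ℝ :=
  sSup ((fun ξ : Euc N => inner ℝ x ξ) '' {ξ | F ξ < 1})

/-- `φ ∈ C_c^∞(ℝ^N)`. -/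
def IsTestFunction {N : ℕ} (φ : Euc N → ℝ) : Prop :=
  ContDiff ℝ ∞ φ ∧ HasCompactSupport φ

/-- `g ∈ L²_loc(ℝ^N; E)`. -/
def MemL2Loc {N : ℕ} {E : Type*} [NormedAddCommGroup E] (g : Euc N → E) : Prop :=
  ∀ K : Set (Euc N), IsCompact K → MemLp g 2 (volume.restrict K)

/-- `u ∈ H¹_loc(ℝ^N)`, and `G` is the weak gradient of `u` (unique up to null sets). -/
structure IsH1LocWithGradient {N : ℕ} (u : Euc N → ℝ) (G : Euc N → Euc N) : Prop where
  memL2Loc : MemL2Loc u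
  memL2Loc_gradient : MemL2Loc G
  integral_eq : ∀ φ : Euc N → ℝ, IsTestFunction φ → ∀ i : Fin N,
    ∫ x, u x * fderiv ℝ φ x (EuclideanSpace.single i 1) = -∫ x, G x i * φ x

/-- `G` being the weak gradient of `u`, `u` satisfies `-Q u = f(x, u)` on `ℝ^N` weakly:
`f(x, u) ∈ L¹_loc` and `∫ F(∇u) F_ξ(∇u) · ∇φ = ∫ f(x, u) φ` for all `φ ∈ C_c^∞`.
Where `∇u = 0` the vector `F(∇u) F_ξ(∇u)` is `0`, as `F(0) = 0`. -/
structure IsWeakSolution {N : ℕ} (F : Euc N → ℝ) (f : Euc N → ℝ → ℝ)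
    (u : Euc N → ℝ) (G : Euc N → Euc N) : Prop where
  h1Loc : IsH1LocWithGradient u G
  locallyIntegrable : LocallyIntegrable (fun x => f x (u x)) volume
  weak_eq : ∀ φ : Euc N → ℝ, IsTestFunction φ →
    ∫ x, F (G x) * fderiv ℝ F (G x) (gradient φ x) = ∫ x, f x (u x) * φ x

/-- The quadratic form `∑ i j, (F_{ξ_i} F_{ξ_j} + F F_{ξ_i ξ_j})(ξ) V_i V_j` for `ξ ≠ 0`, that is,
the second derivative of `F² / 2` at `ξ` in the direction `V`. -/
noncomputable def energyHessian {N : ℕ} (F : Euc N → ℝ) (ξ V : Euc N) : ℝ :=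
  (fderiv ℝ F ξ V) ^ 2 + F ξ * hessForm F ξ V

open Classical in
/-- The integrand of the second variation, with a value at `ξ = 0` as well, where `F` is not
differentiable: there it is the upper limit from `ξ ≠ 0`, the largest of the natural
choices (`F(V)²`, the second derivative of `F² / 2` along the line through `0`, lies below it, and
so does `0`), which makes stability as weak a requirement as possible.
For `F = |·|` it is `|V|²` at every `ξ`. -/
noncomputable def energyHessianExt {N : ℕ} (F : Euc N → ℝ) (ξ V : Euc N) : ℝ :=
  if ξ = 0 then limsup (fun η => energyHessian F η V) (𝓝[≠] 0) else energyHessian F ξ V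

/-- The stability inequality for `u` with weak gradient `G`:
`∫ (F_{ξ_i} F_{ξ_j} + F F_{ξ_i ξ_j})(∇u) φ_{x_i} φ_{x_j} - ∂_u f(x, u) φ² ≥ 0`
for all `φ ∈ C_c^∞`. -/
def IsStable {N : ℕ} (F : Euc N → ℝ) (f : Euc N → ℝ → ℝ)
    (u : Euc N → ℝ) (G : Euc N → Euc N) : Prop :=
  ∀ φ : Euc N → ℝ, IsTestFunction φ →
    0 ≤ ∫ x, (energyHessianExt F (G x) (gradient φ x) - deriv (f x) (u x) * φ x ^ 2)

/-- `u` is a weak stable solution of `-Q u = f(x, u)` on `ℝ^N`. -/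
def IsWeakStableSolution {N : ℕ} (F : Euc N → ℝ) (f : Euc N → ℝ → ℝ) (u : Euc N → ℝ) : Prop :=
  ∃ G : Euc N → Euc N, IsWeakSolution F f u G ∧ IsStable F f u G

/-! The argument is Farina's: play the stability inequality against the weak equation, with test
functions built from the exponential of `u`. Write `g = (F⁰)^α e^u`, which is both the right-hand
side and its `u`-derivative. Formally, stability tested with `e^{pu/2} φ` bounds `∫ g e^{pu} φ²` by
`(p²/4) ∫ e^{pu} F(∇u)² φ²`. The equation tested with `e^{pu} φ²` bounds `p ∫ e^{pu} F(∇u)² φ²` by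
`∫ g e^{pu} φ²`. Both hold up to terms in `∇φ`, and `p²/4 < p` exactly when `p < 4`. So for such `p`
the gradient term can be absorbed, and `∫ g e^{pu} φ² ≤ C ∫ e^{pu} |∇φ|²`.

The anisotropy costs nothing at leading order. By Euler's identities the Hessian of `F` annihilates
the radial direction `∇u`, so the quadratic form at `∇u` in direction `s∇u + W` has leading term `s²
F(∇u)²` and a cross term controlled by `F(∇u)|W|` (`energyHessian_smul_self_add`).

Since `u` is only in `H¹_loc` and `e^u` only in `L¹_loc`, exponentials are not admissible. They are
replaced by `softplus p u`, which is like `e^{pu/2}` at `-∞` but linear at `+∞`, and by `fluxWeight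
p u`. These keep the exact relation `fluxWeight' = (4/p) (softplus')²` together with `fluxWeight ≤
softplus²`, which is all that the absorption uses. Mollifying `u` makes such functions of `u`
admissible (`weak_eq_comp_mul`, `stability_comp_mul`), and the result is `exists_energy_estimate`.

Finally, `softplus² ≤ e^{pu}` lets a Young-type dichotomy (`absorb_le`) absorb the right-hand side,
leaving `∫_{B_R} g softplus² ≤ D R^{N-2-(2+α)p}`. The exponent is negative when `p > (N-2)/(2+α)`.
This is compatible with `p < 4` precisely because `N < 10 + 4α`, and letting `R → ∞` contradicts the
positivity of the integrand. -/

/-! ### Dominated convergence with varying bounds. -/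

section GeneralizedDominatedConvergence

/-- Dominated convergence with a convergent sequence of dominating functions. -/
theorem tendsto_integral_of_tendsto_bound {X : Type*} [MeasurableSpace X] {μ : Measure X}
    {h : ℕ → X → ℝ} {h₀ : X → ℝ} {g : ℕ → X → ℝ} {g₀ : X → ℝ}
    (hg : ∀ n, Integrable (g n) μ) (hg₀ : Integrable g₀ μ)
    (hgae : ∀ᵐ x ∂μ, Tendsto (fun n => g n x) atTop (𝓝 (g₀ x)))
    (hgint : Tendsto (fun n => ∫ x, g n x ∂μ) atTop (𝓝 (∫ x, g₀ x ∂μ)))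
    (hm : ∀ n, AEStronglyMeasurable (h n) μ)
    (hb : ∀ n, ∀ᵐ x ∂μ, |h n x| ≤ g n x)
    (hae : ∀ᵐ x ∂μ, Tendsto (fun n => h n x) atTop (𝓝 (h₀ x))) :
    Tendsto (fun n => ∫ x, h n x ∂μ) atTop (𝓝 (∫ x, h₀ x ∂μ)) := by
  have hm₀ : AEStronglyMeasurable h₀ μ := aestronglyMeasurable_of_tendsto_ae _ hm hae
  have hb₀ : ∀ᵐ x ∂μ, |h₀ x| ≤ g₀ x := by
    filter_upwards [hae, hgae, ae_all_iff.2 hb] with x h1 h2 h3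
    exact le_of_tendsto_of_tendsto' h1.abs h2 h3
  have hi : ∀ n, Integrable (h n) μ := fun n => (hg n).mono' (hm n) (hb n)
  have hi₀ : Integrable h₀ μ := hg₀.mono' hm₀ hb₀
  have hA : Tendsto (fun n => ∫ x, min (|h n x - h₀ x|) (2 * g₀ x) ∂μ) atTop (𝓝 0) := by
    have := tendsto_integral_of_dominated_convergence (μ := μ)
      (F := fun n x => min (|h n x - h₀ x|) (2 * g₀ x)) (f := fun _ => (0 : ℝ))
      (fun x => 2 * g₀ x) (fun n => (((hm n).sub hm₀).norm).inf (hg₀.const_mul 2).1)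
      (hg₀.const_mul 2) ?_ ?_
    · simpa using this
    · intro n
      filter_upwards [hb₀] with x hx
      have : 0 ≤ g₀ x := (abs_nonneg _).trans hx
      rw [Real.norm_eq_abs, abs_of_nonneg (le_min (abs_nonneg _) (by positivity))]
      exact min_le_right _ _
    · filter_upwards [hae, hb₀] with x hx hx₀
      have h0 : 0 ≤ g₀ x := (abs_nonneg _).trans hx₀
      have h1 : Tendsto (fun n => |h n x - h₀ x|) atTop (𝓝 0) := by
        simpa using (hx.sub_const (h₀ x)).abs
      have := h1.min (tendsto_const_nhds (x := 2 * g₀ x))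
      rwa [min_eq_left (by positivity)] at this
  have hB : Tendsto (fun n => ∫ x, max (g₀ x - g n x) 0 ∂μ) atTop (𝓝 0) := by
    have := tendsto_integral_of_dominated_convergence (μ := μ)
      (F := fun n x => max (g₀ x - g n x) 0) (f := fun _ => (0 : ℝ))
      g₀ (fun n => ((hg₀.sub (hg n)).1).sup aestronglyMeasurable_const) hg₀ ?_ ?_
    · simpa using this
    · intro n
      filter_upwards [hb₀, hb n] with x hx hx'
      have h0 : 0 ≤ g₀ x := (abs_nonneg _).trans hx
      have h1 : 0 ≤ g n x := (abs_nonneg _).trans hx'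
      rw [Real.norm_eq_abs, abs_of_nonneg (le_max_right _ _)]
      exact max_le (by linarith) h0
    · filter_upwards [hgae] with x hx
      have := (hx.const_sub (g₀ x)).max (tendsto_const_nhds (x := (0 : ℝ)))
      simpa using this
  -- As `|h n - h₀| ≤ g n + g₀ = 2 g₀ + (g n - g₀)`, the difference is at most the sum of these
  -- three integrands. The first and third are dominated by fixed functions.
  have hC : Tendsto (fun n => (∫ x, min (|h n x - h₀ x|) (2 * g₀ x) ∂μ) +
      ((∫ x, g n x ∂μ) - ∫ x, g₀ x ∂μ) + ∫ x, max (g₀ x - g n x) 0 ∂μ) atTop (𝓝 0) := by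
    simpa using (hA.add (hgint.sub_const (∫ x, g₀ x ∂μ))).add hB
  rw [tendsto_iff_norm_sub_tendsto_zero]
  refine squeeze_zero (fun _ => norm_nonneg _) (fun n => ?_) hC
  have i1 : Integrable (fun x => min (|h n x - h₀ x|) (2 * g₀ x)) μ := by
    refine ((hi n).sub hi₀).abs.mono' ((((hm n).sub hm₀).norm).inf (hg₀.const_mul 2).1) ?_
    filter_upwards [hb₀] with x hx
    have : 0 ≤ g₀ x := (abs_nonneg _).trans hx
    rw [Real.norm_eq_abs, abs_of_nonneg (le_min (abs_nonneg _) (by positivity))]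
    exact min_le_left _ _
  have i2 : Integrable (fun x => max (g₀ x - g n x) 0) μ := (hg₀.sub (hg n)).pos_part
  calc ‖∫ x, h n x ∂μ - ∫ x, h₀ x ∂μ‖ = ‖∫ x, (h n x - h₀ x) ∂μ‖ := by
        rw [integral_sub (hi n) hi₀]
    _ ≤ ∫ x, ‖h n x - h₀ x‖ ∂μ := norm_integral_le_integral_norm _
    _ ≤ ∫ x, (min (|h n x - h₀ x|) (2 * g₀ x) + (g n x - g₀ x) + max (g₀ x - g n x) 0) ∂μ := by
        refine integral_mono_ae ((hi n).sub hi₀).norm ((i1.add ((hg n).sub hg₀)).add i2) ?_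
        filter_upwards [hb n, hb₀] with x h1 h2
        have h3 : |h n x - h₀ x| ≤ |h n x| + |h₀ x| := abs_sub _ _
        simp only [Real.norm_eq_abs]
        rcases min_cases (|h n x - h₀ x|) (2 * g₀ x) with h4 | h4 <;>
        rcases max_cases (g₀ x - g n x) 0 with h5 | h5 <;> linarith
    _ = _ := by
        have i3 : Integrable (fun x => g n x - g₀ x) μ := (hg n).sub hg₀
        have i4 : Integrable (fun x => min (|h n x - h₀ x|) (2 * g₀ x) + (g n x - g₀ x)) μ :=
          i1.add i3
        rw [integral_add i4 i2, integral_add i1 i3, integral_sub (hg n) hg₀]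

end GeneralizedDominatedConvergence

/-! ### Mollification of `H¹_loc` functions. -/

section Mollification

open ContinuousLinearMap Convolution

/-- Jensen's inequality for the square of the norm. -/
theorem norm_integral_smul_sq_le {X V : Type*} [MeasurableSpace X] {μ : Measure X}
    [NormedAddCommGroup V] [NormedSpace ℝ V] {ρ : X → ℝ} {g : X → V} (hρ : ∀ x, 0 ≤ ρ x)
    (hρi : Integrable ρ μ) (hρ1 : ∫ x, ρ x ∂μ = 1) (hg : Integrable (fun x => ρ x • g x) μ)
    (hg2 : Integrable (fun x => ρ x * ‖g x‖ ^ 2) μ) :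
    ‖∫ x, ρ x • g x ∂μ‖ ^ 2 ≤ ∫ x, ρ x * ‖g x‖ ^ 2 ∂μ := by
  have hn : ∀ x, ‖ρ x • g x‖ = ρ x * ‖g x‖ := fun x => by
    rw [norm_smul, Real.norm_of_nonneg (hρ x)]
  have hg1 : Integrable (fun x => ρ x * ‖g x‖) μ := by simpa only [hn] using hg.norm
  set m := ∫ x, ρ x * ‖g x‖ ∂μ with hm
  have h1 : ‖∫ x, ρ x • g x ∂μ‖ ≤ m := by
    simpa only [hn] using norm_integral_le_integral_norm (fun x => ρ x • g x) (μ := μ)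
  -- The variance `∫ ρ (‖g‖ - m)²` is nonnegative.
  have h2 : 0 ≤ ∫ x, (ρ x * ‖g x‖ ^ 2 - 2 * m * (ρ x * ‖g x‖) + m ^ 2 * ρ x) ∂μ :=
    integral_nonneg fun x => by
      have := mul_nonneg (hρ x) (sq_nonneg (‖g x‖ - m))
      simp only [Pi.zero_apply]
      linarith
  have i1 : Integrable (fun x => ρ x * ‖g x‖ ^ 2 - 2 * m * (ρ x * ‖g x‖)) μ :=
    hg2.sub (hg1.const_mul _)
  rw [integral_add i1 (hρi.const_mul _), integral_sub hg2 (hg1.const_mul _), integral_const_mul, integral_const_mul, hρ1, ← hm] at h2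
  have h3 := pow_le_pow_left₀ (norm_nonneg (∫ x, ρ x • g x ∂μ)) h1 2
  linarith

variable {N : ℕ}

theorem MemL2Loc.locallyIntegrable_norm_sq {E : Type*} [NormedAddCommGroup E] {g : Euc N → E}
    (hg : MemL2Loc g) : LocallyIntegrable (fun x => ‖g x‖ ^ 2) := by
  rw [locallyIntegrable_iff]
  intro K hK
  exact (memLp_two_iff_integrable_sq_norm (hg K hK).1).1 (hg K hK)

theorem MemL2Loc.locallyIntegrable {E : Type*} [NormedAddCommGroup E] {g : Euc N → E}
    (hg : MemL2Loc g) : LocallyIntegrable g := by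
  rw [locallyIntegrable_iff]
  intro K hK
  have : IsFiniteMeasure (volume.restrict K) := ⟨by simpa using hK.measure_lt_top⟩
  exact (hg K hK).integrable (by norm_num)

theorem gradient_apply_eq_fderiv (v : Euc N → ℝ) (x : Euc N) (i : Fin N) :
    gradient v x i = fderiv ℝ v x (EuclideanSpace.single i 1) := by
  have := EuclideanSpace.inner_single_right i (1 : ℝ) (gradient v x)
  rw [gradient, InnerProductSpace.toDual_symm_apply] at this
  simpa [gradient] using this.symm

theorem fderiv_mollification_apply {u : Euc N → ℝ} (hu : LocallyIntegrable u) {ρ : Euc N → ℝ}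
    (hρ : IsTestFunction ρ) (x e : Euc N) :
    fderiv ℝ (ρ ⋆[lsmul ℝ ℝ, volume] u) x e = ∫ t, fderiv ℝ ρ t e * u (x - t) := by
  have hρ1 : ContDiff ℝ 1 ρ := hρ.1.of_le (by simp)
  have hc : Continuous (fderiv ℝ ρ) := hρ1.continuous_fderiv one_ne_zero
  have hint := (hρ.2.fderiv (𝕜 := ℝ)).convolutionExists_left
    (precompL (Euc N) (lsmul ℝ ℝ : ℝ →L[ℝ] ℝ →L[ℝ] ℝ)) hc hu x
  rw [(hρ.2.hasFDerivAt_convolution_left (lsmul ℝ ℝ) hρ1 hu x).fderiv, convolution_def,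
    ContinuousLinearMap.integral_apply hint]
  simp only [precompL_apply, lsmul_apply, smul_eq_mul]

theorem mollification_apply {G : Euc N → Euc N} (hG : LocallyIntegrable G) {ρ : Euc N → ℝ}
    (hρ : IsTestFunction ρ) (x : Euc N) (i : Fin N) :
    (ρ ⋆[lsmul ℝ ℝ, volume] G) x i = ∫ t, ρ t * G (x - t) i := by
  have hint : Integrable (fun t => ρ t • G (x - t)) :=
    hρ.2.convolutionExists_left (lsmul ℝ ℝ) hρ.1.continuous hG x
  exact ((EuclideanSpace.proj (𝕜 := ℝ) i).integral_comp_comm hint).symm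

theorem IsTestFunction.comp_sub_left {ρ : Euc N → ℝ} (hρ : IsTestFunction ρ) (x : Euc N) :
    IsTestFunction fun y => ρ (x - y) :=
  ⟨hρ.1.comp (contDiff_const.sub contDiff_id), hρ.2.comp_homeomorph (Homeomorph.subLeft x)⟩

theorem fderiv_comp_sub_left {ρ : Euc N → ℝ} (hρ : Differentiable ℝ ρ) (x y e : Euc N) :
    fderiv ℝ (fun y => ρ (x - y)) y e = - fderiv ℝ ρ (x - y) e := by
  have h1 : HasFDerivAt (fun y : Euc N => x - y) (-ContinuousLinearMap.id ℝ (Euc N)) y :=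
    (hasFDerivAt_id y).const_sub x
  have h2 : HasFDerivAt (fun y => ρ (x - y)) _ y := (hρ (x - y)).hasFDerivAt.comp y h1
  rw [h2.fderiv]
  simp

/-- The gradient of the mollification is the mollification of the weak gradient. -/
theorem gradient_mollification {u : Euc N → ℝ} {G : Euc N → Euc N}
    (hu : IsH1LocWithGradient u G) {ρ : Euc N → ℝ} (hρ : IsTestFunction ρ) (x : Euc N) :
    gradient (ρ ⋆[lsmul ℝ ℝ, volume] u) x = (ρ ⋆[lsmul ℝ ℝ, volume] G) x := by
  ext i
  rw [gradient_apply_eq_fderiv, fderiv_mollification_apply hu.memL2Loc.locallyIntegrable hρ,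
    mollification_apply hu.memL2Loc_gradient.locallyIntegrable hρ]
  have h4 := hu.integral_eq _ (hρ.comp_sub_left x) i
  simp only [fderiv_comp_sub_left (hρ.1.differentiable (by simp)), mul_neg, integral_neg,
    neg_inj] at h4
  rw [← integral_sub_left_eq_self (fun t => ρ t * G (x - t) i) volume x,
    ← integral_sub_left_eq_self (fun t => fderiv ℝ ρ t _ * u (x - t)) volume x]
  simpa [mul_comm] using h4

theorem norm_convolution_sq_le {V : Type*} [NormedAddCommGroup V] [NormedSpace ℝ V]
    {g : Euc N → V} (hg : MemL2Loc g) {ρ : Euc N → ℝ} (hρ : IsTestFunction ρ)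
    (hρ0 : ∀ x, 0 ≤ ρ x) (hρ1 : ∫ x, ρ x = 1) (x : Euc N) :
    ‖(ρ ⋆[lsmul ℝ ℝ, volume] g) x‖ ^ 2 ≤ (ρ ⋆[lsmul ℝ ℝ, volume] fun y => ‖g y‖ ^ 2) x :=
  norm_integral_smul_sq_le hρ0 (hρ.1.continuous.integrable_of_hasCompactSupport hρ.2) hρ1
    (hρ.2.convolutionExists_left (lsmul ℝ ℝ) hρ.1.continuous hg.locallyIntegrable x)
    (hρ.2.convolutionExists_left (lsmul ℝ ℝ) hρ.1.continuous hg.locallyIntegrable_norm_sq x)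

/-- Smooth approximation of `H¹_loc` functions, packaged for passing to the limit in integrals. -/
theorem IsH1LocWithGradient.exists_smooth_approx {u : Euc N → ℝ} {G : Euc N → Euc N}
    (hu : IsH1LocWithGradient u G) :
    ∃ v : ℕ → Euc N → ℝ, (∀ n, ContDiff ℝ ∞ (v n)) ∧
      (∀ᵐ x, Tendsto (fun n => v n x) atTop (𝓝 (u x))) ∧
      (∀ᵐ x, Tendsto (fun n => gradient (v n) x) atTop (𝓝 (G x))) ∧
      ∀ (r C : ℝ) (h : ℕ → Euc N → ℝ) (h₀ : Euc N → ℝ),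
        (∀ n, AEStronglyMeasurable (h n)) →
        (∀ᵐ x, Tendsto (fun n => h n x) atTop (𝓝 (h₀ x))) →
        (∀ n x, r < ‖x‖ → h n x = 0) →
        (∀ n x, |h n x| ≤ C * (1 + u x ^ 2 + ‖G x‖ ^ 2 + v n x ^ 2 + ‖gradient (v n) x‖ ^ 2)) →
        Tendsto (fun n => ∫ x, h n x) atTop (𝓝 (∫ x, h₀ x)) := by
  have hδ : ∀ n : ℕ, (0 : ℝ) < 1 / (n + 1) := fun n => by positivity
  let φ : ℕ → ContDiffBump (0 : Euc N) := fun n =>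
    ⟨1 / (n + 1) / 2, 1 / (n + 1), half_pos (hδ n), half_lt_self (hδ n)⟩
  have hφ : Tendsto (fun n => (φ n).rOut) atTop (𝓝 0) := tendsto_one_div_add_atTop_nhds_zero_nat
  -- A bounded ratio of the radii is what the Lebesgue differentiation argument for a.e. convergence
  -- needs.
  have hφ' : ∀ᶠ n in atTop, (φ n).rOut ≤ 2 * (φ n).rIn :=
    Eventually.of_forall fun n => le_of_eq (by simp only [φ]; ring)
  have hφ1 : ∀ n, (φ n).rOut ≤ 1 := fun n => by
    simp only [φ]
    rw [div_le_one (by positivity)]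
    linarith [Nat.cast_nonneg (α := ℝ) n]
  have hρ : ∀ n, IsTestFunction ((φ n).normed volume) := fun n =>
    ⟨(φ n).contDiff_normed, (φ n).hasCompactSupport_normed⟩
  have hρ0 : ∀ n x, 0 ≤ (φ n).normed volume x := fun n x => (φ n).nonneg_normed x
  have hρi : ∀ n, ∫ x, (φ n).normed volume x = 1 := fun n => (φ n).integral_normed
  have hul := hu.memL2Loc.locallyIntegrable
  have hGl := hu.memL2Loc_gradient.locallyIntegrable
  refine ⟨fun n => (φ n).normed volume ⋆[lsmul ℝ ℝ, volume] u, fun n => ?_, ?_, ?_, ?_⟩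
  · exact (φ n).hasCompactSupport_normed.contDiff_convolution_left (n := ⊤) _
      (φ n).contDiff_normed hul
  · exact ContDiffBump.ae_convolution_tendsto_right_of_locallyIntegrable hφ hφ' hul
  · simp only [gradient_mollification hu (hρ _)]
    exact ContDiffBump.ae_convolution_tendsto_right_of_locallyIntegrable hφ hφ' hGl
  · intro r C h h₀ hm hae hr hb
    simp only [gradient_mollification hu (hρ _)] at hb
    set w : Euc N → ℝ := fun x => 1 + u x ^ 2 + ‖G x‖ ^ 2 with hw
    have hu2 : LocallyIntegrable fun x => u x ^ 2 := by
      simpa using hu.memL2Loc.locallyIntegrable_norm_sq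
    have hG2 := hu.memL2Loc_gradient.locallyIntegrable_norm_sq
    have hwl : LocallyIntegrable w := ((locallyIntegrable_const 1).add hu2).add hG2
    -- The mollifiers live in the unit ball, so on the ball of radius `r` the mollifications see `w`
    -- only inside radius `r + 1`. Truncating there makes the bound globally integrable.
    set g : Euc N → ℝ := (Metric.closedBall 0 (r + 1)).indicator w with hg
    have hgi : Integrable g := by
      rw [hg, integrable_indicator_iff Metric.isClosed_closedBall.measurableSet]
      exact hwl.integrableOn_isCompact (isCompact_closedBall _ _)
    have hci : ∀ n, Integrable ((φ n).normed volume ⋆[lsmul ℝ ℝ, volume] g) := fun n =>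
      ((hρ n).1.continuous.integrable_of_hasCompactSupport (hρ n).2).integrable_convolution _ hgi
    have hgl := hgi.locallyIntegrable
    have hconv : ∀ n x, ‖x‖ ≤ r →
        (((φ n).normed volume ⋆[lsmul ℝ ℝ, volume] u) x) ^ 2 +
          ‖((φ n).normed volume ⋆[lsmul ℝ ℝ, volume] G) x‖ ^ 2 ≤
        ((φ n).normed volume ⋆[lsmul ℝ ℝ, volume] g) x := by
      intro n x hx
      have e1 := norm_convolution_sq_le hu.memL2Loc (hρ n) (hρ0 n) (hρi n) x
      have e2 := norm_convolution_sq_le hu.memL2Loc_gradient (hρ n) (hρ0 n) (hρi n) x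
      rw [Real.norm_eq_abs, sq_abs] at e1
      refine (add_le_add e1 e2).trans ?_
      have c1 : Integrable fun t => (φ n).normed volume t * ‖u (x - t)‖ ^ 2 :=
        (hρ n).2.convolutionExists_left (lsmul ℝ ℝ) (hρ n).1.continuous
          hu.memL2Loc.locallyIntegrable_norm_sq x
      have c2 : Integrable fun t => (φ n).normed volume t * ‖G (x - t)‖ ^ 2 :=
        (hρ n).2.convolutionExists_left (lsmul ℝ ℝ) (hρ n).1.continuous hG2 x
      have c3 : Integrable fun t => (φ n).normed volume t * g (x - t) :=
        (hρ n).2.convolutionExists_left (lsmul ℝ ℝ) (hρ n).1.continuous hgl x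
      change (∫ t, (φ n).normed volume t * ‖u (x - t)‖ ^ 2) +
        (∫ t, (φ n).normed volume t * ‖G (x - t)‖ ^ 2) ≤ ∫ t, (φ n).normed volume t * g (x - t)
      rw [← integral_add c1 c2]
      refine integral_mono (c1.add c2) c3 fun t => ?_
      simp only
      by_cases ht : (φ n).normed volume t = 0
      · simp [ht]
      have ht' : t ∈ Function.support ((φ n).normed volume) := ht
      rw [ContDiffBump.support_normed_eq, mem_ball_zero_iff] at ht'
      have hmem : x - t ∈ Metric.closedBall (0 : Euc N) (r + 1) := by
        rw [mem_closedBall_zero_iff]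
        linarith [norm_sub_le x t, hφ1 n]
      rw [hg, Set.indicator_of_mem hmem, ← mul_add, Real.norm_eq_abs, sq_abs]
      refine mul_le_mul_of_nonneg_left ?_ (hρ0 n t)
      simp only [hw]
      linarith
    have hC : ∀ n x, |h n x| ≤ |C| * (g x + ((φ n).normed volume ⋆[lsmul ℝ ℝ, volume] g) x) := by
      intro n x
      by_cases hx : ‖x‖ ≤ r
      · refine (hb n x).trans ?_
        have hpos : (0 : ℝ) ≤ 1 + u x ^ 2 + ‖G x‖ ^ 2 +
          (((φ n).normed volume ⋆[lsmul ℝ ℝ, volume] u) x) ^ 2 +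
          ‖((φ n).normed volume ⋆[lsmul ℝ ℝ, volume] G) x‖ ^ 2 := by positivity
        refine mul_le_mul (le_abs_self C) ?_ hpos (abs_nonneg C)
        have hmem : x ∈ Metric.closedBall (0 : Euc N) (r + 1) := by
          rw [mem_closedBall_zero_iff]; linarith
        rw [hg, Set.indicator_of_mem hmem, ← hg]
        have := hconv n x hx
        simp only [hw]
        linarith
      · rw [hr n x (not_le.1 hx), abs_zero]
        refine mul_nonneg (abs_nonneg C) (add_nonneg ?_ ?_)
        · exact Set.indicator_nonneg (fun y _ => by simp only [hw]; positivity) _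
        · exact integral_nonneg fun t => mul_nonneg (hρ0 n t)
            (Set.indicator_nonneg (fun y _ => by simp only [hw]; positivity) _)
    refine tendsto_integral_of_tendsto_bound
      (g := fun n x => |C| * (g x + ((φ n).normed volume ⋆[lsmul ℝ ℝ, volume] g) x))
      (g₀ := fun x => |C| * (g x + g x)) (fun n => (hgi.add (hci n)).const_mul _)
      ((hgi.add hgi).const_mul _) ?_ ?_ hm (fun n => Eventually.of_forall (hC n)) hae
    · filter_upwards [ContDiffBump.ae_convolution_tendsto_right_of_locallyIntegrable hφ hφ' hgl]
        with x hx
      exact (hx.const_add _).const_mul _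
    -- Convolution with a function of mass one preserves the integral, so the integrals of the
    -- bounds do not depend on `n`.
    · refine tendsto_const_nhds.congr fun n => ?_
      rw [integral_const_mul, integral_const_mul, integral_add hgi (hci n), integral_add hgi hgi,
        integral_convolution _ ((hρ n).1.continuous.integrable_of_hasCompactSupport (hρ n).2) hgi,
        hρi n]
      simp

end Mollification

/-! ### Homogeneity and growth of the Finsler norm, its energy form and its support function. -/

namespace IsFinslerNorm

variable {N : ℕ} {F : Euc N → ℝ}

theorem contDiffAt (hF : IsFinslerNorm F) {ξ : Euc N} (hξ : ξ ≠ 0) : ContDiffAt ℝ 2 F ξ :=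
  hF.contDiff.contDiffAt (isOpen_compl_singleton.mem_nhds hξ)

theorem differentiableAt (hF : IsFinslerNorm F) {ξ : Euc N} (hξ : ξ ≠ 0) :
    DifferentiableAt ℝ F ξ :=
  (hF.contDiffAt hξ).differentiableAt two_ne_zero

theorem contDiffAt_fderiv (hF : IsFinslerNorm F) {ξ : Euc N} (hξ : ξ ≠ 0) :
    ContDiffAt ℝ 1 (fderiv ℝ F) ξ :=
  (hF.contDiffAt hξ).fderiv_right (by norm_num)

theorem differentiableAt_fderiv (hF : IsFinslerNorm F) {ξ : Euc N} (hξ : ξ ≠ 0) :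
    DifferentiableAt ℝ (fderiv ℝ F) ξ :=
  (hF.contDiffAt_fderiv hξ).differentiableAt one_ne_zero

theorem map_zero (hF : IsFinslerNorm F) : F 0 = 0 := by
  simpa using hF.homogeneous 0 0

/-- Euler's identity. -/
theorem fderiv_apply_self (hF : IsFinslerNorm F) {ξ : Euc N} (hξ : ξ ≠ 0) :
    fderiv ℝ F ξ ξ = F ξ := by
  have hl : HasDerivAt (fun t : ℝ => t • ξ) ξ 1 := by
    simpa using (hasDerivAt_id (1 : ℝ)).smul_const ξ
  have h0 : HasFDerivAt F (fderiv ℝ F ξ) ((1 : ℝ) • ξ) := by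
    rw [one_smul]; exact (hF.differentiableAt hξ).hasFDerivAt
  have h1 : HasDerivAt (fun t : ℝ => F (t • ξ)) (fderiv ℝ F ξ ξ) 1 :=
    h0.comp_hasDerivAt 1 hl
  have h2 : HasDerivAt (fun t : ℝ => F (t • ξ)) (F ξ) 1 := by
    have : HasDerivAt (fun t : ℝ => t * F ξ) (F ξ) 1 := by
      simpa using (hasDerivAt_id (1 : ℝ)).mul_const (F ξ)
    refine this.congr_of_eventuallyEq ?_
    filter_upwards [lt_mem_nhds (zero_lt_one (α := ℝ))] with t ht
    rw [hF.homogeneous, abs_of_pos ht]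
  exact h1.unique h2

theorem fderiv_smul (hF : IsFinslerNorm F) {t : ℝ} (ht : 0 < t) (ξ : Euc N) :
    fderiv ℝ F (t • ξ) = fderiv ℝ F ξ := by
  have h1 : (fun η => F (t • η)) = t • F := by
    ext η
    simp [hF.homogeneous, abs_of_pos ht]
  have h2 := fderiv_comp_smul (𝕜 := ℝ) (f := F) (x := ξ) t
  rw [h1, fderiv_const_smul_field] at h2
  exact (smul_right_injective _ ht.ne' h2).symm

theorem fderiv_fderiv_smul (hF : IsFinslerNorm F) {t : ℝ} (ht : 0 < t) (ξ : Euc N) :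
    t • fderiv ℝ (fderiv ℝ F) (t • ξ) = fderiv ℝ (fderiv ℝ F) ξ := by
  have h1 : (fun η => fderiv ℝ F (t • η)) = fderiv ℝ F := funext (hF.fderiv_smul ht)
  have h2 := fderiv_comp_smul (𝕜 := ℝ) (f := fderiv ℝ F) (x := ξ) t
  rw [h1] at h2
  exact h2.symm

/-- The gradient is homogeneous of degree zero, hence constant along rays. -/
theorem fderiv_fderiv_apply_self_left (hF : IsFinslerNorm F) {ξ : Euc N} (hξ : ξ ≠ 0) :
    fderiv ℝ (fderiv ℝ F) ξ ξ = 0 := by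
  have hl : HasDerivAt (fun t : ℝ => t • ξ) ξ 1 := by
    simpa using (hasDerivAt_id (1 : ℝ)).smul_const ξ
  have h0 : HasFDerivAt (fderiv ℝ F) (fderiv ℝ (fderiv ℝ F) ξ) ((1 : ℝ) • ξ) := by
    rw [one_smul]; exact (hF.differentiableAt_fderiv hξ).hasFDerivAt
  have h1 : HasDerivAt (fun t : ℝ => fderiv ℝ F (t • ξ)) (fderiv ℝ (fderiv ℝ F) ξ ξ) 1 :=
    h0.comp_hasDerivAt 1 hl
  have h2 : HasDerivAt (fun t : ℝ => fderiv ℝ F (t • ξ)) 0 1 := by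
    refine (hasDerivAt_const (1 : ℝ) (fderiv ℝ F ξ)).congr_of_eventuallyEq ?_
    filter_upwards [lt_mem_nhds (zero_lt_one (α := ℝ))] with t ht
    exact hF.fderiv_smul ht ξ
  exact h1.unique h2

/-- Differentiating Euler's identity `DF(η) η = F(η)` in the direction `W` produces `DF(ξ) W` on
both sides; what remains is this term. -/
theorem fderiv_fderiv_apply_self_right (hF : IsFinslerNorm F) {ξ : Euc N} (hξ : ξ ≠ 0)
    (W : Euc N) : fderiv ℝ (fderiv ℝ F) ξ W ξ = 0 := by
  have h1 : HasFDerivAt (fun η => fderiv ℝ F η η) _ ξ :=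
    (hF.differentiableAt_fderiv hξ).hasFDerivAt.clm_apply (hasFDerivAt_id ξ)
  have h2 : HasFDerivAt (fun η => fderiv ℝ F η η) (fderiv ℝ F ξ) ξ := by
    refine (hF.differentiableAt hξ).hasFDerivAt.congr_of_eventuallyEq ?_
    filter_upwards [isOpen_compl_singleton.mem_nhds hξ] with η hη
    exact hF.fderiv_apply_self hη
  have h3 := congrArg (fun L => L W) (h1.unique h2)
  simpa using h3

/-- Both quantities are homogeneous of degree zero up to the factor `F ξ / ‖ξ‖ ≤ b`, so compactness
of the unit sphere suffices. -/
theorem exists_bound (hF : IsFinslerNorm F) : ∃ C, 0 < C ∧ ∀ ξ : Euc N, ξ ≠ 0 →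
    ‖fderiv ℝ F ξ‖ ≤ C ∧ F ξ * ‖fderiv ℝ (fderiv ℝ F) ξ‖ ≤ C := by
  obtain ⟨a, b, ha, hab, hF2⟩ := hF.comparable
  have hne : ∀ ξ ∈ Metric.sphere (0 : Euc N) 1, ξ ≠ 0 := fun ξ hξ =>
    ne_zero_of_mem_unit_sphere ⟨ξ, hξ⟩
  obtain ⟨C₁, h₁⟩ := (isCompact_sphere (0 : Euc N) 1).exists_bound_of_continuousOn
    (f := fderiv ℝ F) fun ξ hξ => (hF.contDiffAt_fderiv (hne ξ hξ)).continuousAt.continuousWithinAt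
  obtain ⟨C₂, h₂⟩ := (isCompact_sphere (0 : Euc N) 1).exists_bound_of_continuousOn
    (f := fderiv ℝ (fderiv ℝ F)) fun ξ hξ =>
      ((hF.contDiffAt_fderiv (hne ξ hξ)).fderiv_right (m := 0)
        (by norm_num)).continuousAt.continuousWithinAt
  refine ⟨max 1 (max C₁ (b * C₂)), by positivity, fun ξ hξ => ?_⟩
  have hn : 0 < ‖ξ‖ := norm_pos_iff.2 hξ
  have hmem : ‖ξ‖⁻¹ • ξ ∈ Metric.sphere (0 : Euc N) 1 := by
    simp [norm_smul, hn.ne']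
  constructor
  · rw [← hF.fderiv_smul (inv_pos.2 hn)]
    exact (h₁ _ hmem).trans ((le_max_left _ _).trans (le_max_right _ _))
  · have h5 := ContinuousLinearMap.opNorm_smul_le (‖ξ‖⁻¹)
      (fderiv ℝ (fderiv ℝ F) (‖ξ‖⁻¹ • ξ))
    rw [hF.fderiv_fderiv_smul (inv_pos.2 hn), norm_inv, norm_norm] at h5
    refine (mul_le_mul_of_nonneg_left h5 (hF.nonneg ξ)).trans ?_
    have h3 := h₂ _ hmem
    have h4 : F ξ * ‖ξ‖⁻¹ ≤ b := by
      rw [← div_eq_mul_inv, div_le_iff₀ hn]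
      exact (hF2 ξ).2
    calc F ξ * (‖ξ‖⁻¹ * ‖fderiv ℝ (fderiv ℝ F) (‖ξ‖⁻¹ • ξ)‖)
        = (F ξ * ‖ξ‖⁻¹) * ‖fderiv ℝ (fderiv ℝ F) (‖ξ‖⁻¹ • ξ)‖ := by ring
      _ ≤ b * C₂ := mul_le_mul h4 h3 (ContinuousLinearMap.opNorm_nonneg _) (ha.le.trans hab)
      _ ≤ _ := (le_max_right _ _).trans (le_max_right _ _)

/-- Euler's identities remove every Hessian term involving the radial direction. This gives the
sharp coefficient in the stability inequality, since with `ξ = ∇u` the radial part contributes only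
`s² F²`. -/
theorem energyHessian_smul_self_add (hF : IsFinslerNorm F) {ξ : Euc N} (hξ : ξ ≠ 0) (s : ℝ)
    (W : Euc N) : energyHessian F ξ (s • ξ + W) =
      s ^ 2 * F ξ ^ 2 + 2 * s * (F ξ * fderiv ℝ F ξ W) + energyHessian F ξ W := by
  simp only [energyHessian, hessForm, map_add, map_smul, add_apply,
    smul_apply, hF.fderiv_apply_self hξ, hF.fderiv_fderiv_apply_self_left hξ,
    hF.fderiv_fderiv_apply_self_right hξ, smul_eq_mul, zero_apply]
  ring

theorem exists_abs_energyHessian_sub_le (hF : IsFinslerNorm F) : ∃ C, 0 < C ∧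
    ∀ ξ : Euc N, ξ ≠ 0 → ∀ V W, |energyHessian F ξ V - energyHessian F ξ W| ≤
      C * (‖V - W‖ * (‖V‖ + ‖W‖)) := by
  obtain ⟨C, hC, h⟩ := hF.exists_bound
  refine ⟨C ^ 2 + C, by positivity, fun ξ hξ V W => ?_⟩
  obtain ⟨h1, h2⟩ := h ξ hξ
  set D := fderiv ℝ F ξ
  set H := fderiv ℝ (fderiv ℝ F) ξ
  have e : energyHessian F ξ V - energyHessian F ξ W =
      D (V - W) * D (V + W) + F ξ * (H (V - W) V + H W (V - W)) := by
    simp only [energyHessian, hessForm, map_sub, map_add, sub_apply]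
    change (D V) ^ 2 + F ξ * H V V - ((D W) ^ 2 + F ξ * H W W) = _
    ring
  have b1 : ∀ Z, |D Z| ≤ C * ‖Z‖ := fun Z =>
    (D.le_opNorm Z).trans (mul_le_mul_of_nonneg_right h1 (norm_nonneg _))
  have b2 : ∀ Z Y, F ξ * |H Z Y| ≤ C * (‖Z‖ * ‖Y‖) := fun Z Y => by
    calc F ξ * |H Z Y| ≤ F ξ * (‖H‖ * ‖Z‖ * ‖Y‖) :=
          mul_le_mul_of_nonneg_left (H.le_opNorm₂ Z Y) (hF.nonneg ξ)
      _ = (F ξ * ‖H‖) * (‖Z‖ * ‖Y‖) := by ring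
      _ ≤ _ := mul_le_mul_of_nonneg_right h2 (by positivity)
  rw [e]
  calc |D (V - W) * D (V + W) + F ξ * (H (V - W) V + H W (V - W))|
      ≤ |D (V - W)| * |D (V + W)| + F ξ * (|H (V - W) V| + |H W (V - W)|) := by
        refine (abs_add_le _ _).trans ?_
        rw [abs_mul, abs_mul, abs_of_nonneg (hF.nonneg ξ)]
        exact add_le_add le_rfl (mul_le_mul_of_nonneg_left (abs_add_le _ _) (hF.nonneg ξ))
    _ ≤ (C * ‖V - W‖) * (C * (‖V‖ + ‖W‖)) +
        (C * (‖V - W‖ * ‖V‖) + C * (‖W‖ * ‖V - W‖)) := by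
        rw [mul_add]
        refine add_le_add (mul_le_mul (b1 _) ((b1 _).trans ?_) (abs_nonneg _) (by positivity))
          (add_le_add (b2 _ _) (b2 _ _))
        exact mul_le_mul_of_nonneg_left (norm_add_le _ _) hC.le
    _ = _ := by ring

/-- The estimate for `ξ ≠ 0` is uniform in `ξ`, so it survives the upper limit. It also provides the
boundedness without which the real `limsup` would be a default value. -/
theorem exists_abs_energyHessianExt_sub_le (hF : IsFinslerNorm F) (hN : 2 ≤ N) : ∃ C, 0 < C ∧
    ∀ ξ V W : Euc N, |energyHessianExt F ξ V - energyHessianExt F ξ W| ≤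
      C * (‖V - W‖ * (‖V‖ + ‖W‖)) := by
  have : Nonempty (Fin N) := ⟨⟨0, by lia⟩⟩
  have hnb : (𝓝[≠] (0 : Euc N)).NeBot := Module.punctured_nhds_neBot ℝ _ 0
  obtain ⟨C, hC, h⟩ := hF.exists_abs_energyHessian_sub_le
  refine ⟨C, hC, fun ξ V W => ?_⟩
  by_cases hξ : ξ = 0
  swap
  · simpa [energyHessianExt, hξ] using h ξ hξ V W
  have hb : ∀ V : Euc N, ∀ᶠ η in 𝓝[≠] (0 : Euc N), |energyHessian F η V| ≤ C * (‖V‖ * ‖V‖) := by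
    intro V
    filter_upwards [self_mem_nhdsWithin] with η hη
    simpa [energyHessian, hessForm] using h η hη V 0
  have hbdd : ∀ V : Euc N,
      IsBoundedUnder (· ≤ ·) (𝓝[≠] (0 : Euc N)) fun η => energyHessian F η V := fun V =>
    isBoundedUnder_of_eventually_le ((hb V).mono fun η h => (abs_le.1 h).2)
  have hcob : ∀ V : Euc N,
      IsBoundedUnder (· ≥ ·) (𝓝[≠] (0 : Euc N)) fun η => energyHessian F η V := fun V =>
    isBoundedUnder_of_eventually_ge ((hb V).mono fun η h => (abs_le.1 h).1)
  have key : ∀ V W : Euc N, limsup (fun η => energyHessian F η V) (𝓝[≠] (0 : Euc N)) ≤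
      limsup (fun η => energyHessian F η W) (𝓝[≠] (0 : Euc N)) +
        C * (‖V - W‖ * (‖V‖ + ‖W‖)) := by
    intro V W
    refine (limsup_le_limsup (v := fun η => energyHessian F η W + C * (‖V - W‖ * (‖V‖ + ‖W‖)))
      ?_ (hcob V).isCoboundedUnder_le ?_).trans_eq ?_
    · filter_upwards [self_mem_nhdsWithin] with η hη
      linarith [(abs_le.1 (h η hη V W)).2]
    · exact isBoundedUnder_of_eventually_le
        ((hb W).mono fun η h => add_le_add_left (abs_le.1 h).2 _)
    · exact limsup_add_const _ _ _ (hbdd W) (hcob W).isCoboundedUnder_le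
  simp only [energyHessianExt, hξ, if_true]
  rw [abs_le]
  have k1 := key V W
  have k2 := key W V
  rw [norm_sub_rev, add_comm ‖W‖] at k2
  constructor <;> linarith

theorem energyHessianExt_zero_right (hN : 2 ≤ N) (ξ : Euc N) : energyHessianExt F ξ 0 = 0 := by
  have : Nonempty (Fin N) := ⟨⟨0, by lia⟩⟩
  have hnb : (𝓝[≠] (0 : Euc N)).NeBot := Module.punctured_nhds_neBot ℝ _ 0
  simp [energyHessianExt, energyHessian, hessForm]

theorem exists_abs_energyHessianExt_le (hF : IsFinslerNorm F) (hN : 2 ≤ N) : ∃ C, 0 < C ∧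
    ∀ ξ V : Euc N, |energyHessianExt F ξ V| ≤ C * ‖V‖ ^ 2 := by
  obtain ⟨C, hC, h⟩ := hF.exists_abs_energyHessianExt_sub_le hN
  refine ⟨C, hC, fun ξ V => ?_⟩
  simpa [energyHessianExt_zero_right hN, sq] using h ξ V 0

/-- Only the direction is approximated when testing, while the base point stays at `∇u`. Continuity
in `ξ`, which may fail at `0`, is never required. -/
theorem continuous_energyHessianExt (hF : IsFinslerNorm F) (hN : 2 ≤ N) (ξ : Euc N) :
    Continuous (energyHessianExt F ξ) := by
  obtain ⟨C, hC, h⟩ := hF.exists_abs_energyHessianExt_sub_le hN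
  rw [continuous_iff_continuousAt]
  intro V
  rw [ContinuousAt, tendsto_iff_norm_sub_tendsto_zero]
  refine squeeze_zero (fun _ => norm_nonneg _) (fun W => h ξ W V) ?_
  have : Continuous fun W : Euc N => C * (‖W - V‖ * (‖W‖ + ‖V‖)) := by fun_prop
  simpa using this.tendsto V

theorem measurable_energyHessianExt (hF : IsFinslerNorm F) (hN : 2 ≤ N) :
    Measurable fun p : Euc N × Euc N => energyHessianExt F p.1 p.2 := by
  classical
  have hs : MeasurableSet {p : Euc N × Euc N | p.1 = 0} := measurable_fst (measurableSet_singleton 0)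
  have e : (fun p : Euc N × Euc N => energyHessianExt F p.1 p.2) =
      {p : Euc N × Euc N | p.1 = 0}.piecewise (fun p => energyHessianExt F 0 p.2)
        fun p => energyHessian F p.1 p.2 := by
    ext p
    by_cases hp : p.1 = 0
    · rw [Set.piecewise_eq_of_mem _ _ _ (by exact hp), hp]
    · rw [Set.piecewise_eq_of_notMem _ _ _ (by exact hp), energyHessianExt, if_neg hp]
  rw [e]
  refine ContinuousOn.measurable_piecewise
    ((hF.continuous_energyHessianExt hN 0).comp continuous_snd).continuousOn ?_ hs
  intro p hp
  have hp : p.1 ≠ 0 := hp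
  have c1 : ContinuousAt (fun p : Euc N × Euc N => fderiv ℝ F p.1) p :=
    (hF.contDiffAt_fderiv hp).continuousAt.comp continuousAt_fst
  have c2 : ContinuousAt (fun p : Euc N × Euc N => fderiv ℝ (fderiv ℝ F) p.1) p :=
    ((hF.contDiffAt_fderiv hp).fderiv_right (m := 0) (by norm_num)).continuousAt.comp
      continuousAt_fst
  have c3 : ContinuousAt (fun p : Euc N × Euc N => F p.1) p :=
    (hF.contDiffAt hp).continuousAt.comp continuousAt_fst
  exact (((c1.clm_apply continuousAt_snd).pow 2).add
    (c3.mul ((c2.clm_apply continuousAt_snd).clm_apply continuousAt_snd))).continuousWithinAt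

/-- At `ξ = 0` the factor `F 0 = 0` cancels whatever value `fderiv` takes there; elsewhere the
expression is continuous. -/
theorem measurable_mul_fderiv (hF : IsFinslerNorm F) :
    Measurable fun p : Euc N × Euc N => F p.1 * fderiv ℝ F p.1 p.2 := by
  classical
  have hs : MeasurableSet {p : Euc N × Euc N | p.1 = 0} := measurable_fst (measurableSet_singleton 0)
  have e : (fun p : Euc N × Euc N => F p.1 * fderiv ℝ F p.1 p.2) =
      {p : Euc N × Euc N | p.1 = 0}.piecewise (fun _ => 0)
        fun p => F p.1 * fderiv ℝ F p.1 p.2 := by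
    ext p
    by_cases hp : p.1 = 0
    · rw [Set.piecewise_eq_of_mem _ _ _ (by exact hp), hp, hF.map_zero, zero_mul]
    · rw [Set.piecewise_eq_of_notMem _ _ _ (by exact hp)]
  rw [e]
  refine ContinuousOn.measurable_piecewise continuousOn_const ?_ hs
  intro p hp
  have hp : p.1 ≠ 0 := hp
  have c1 : ContinuousAt (fun p : Euc N × Euc N => fderiv ℝ F p.1) p :=
    (hF.contDiffAt_fderiv hp).continuousAt.comp continuousAt_fst
  have c3 : ContinuousAt (fun p : Euc N × Euc N => F p.1) p :=
    (hF.contDiffAt hp).continuousAt.comp continuousAt_fst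
  exact (c3.mul (c1.clm_apply continuousAt_snd)).continuousWithinAt

theorem measurable_sq (hF : IsFinslerNorm F) : Measurable fun ξ => F ξ ^ 2 := by
  have e : (fun ξ => F ξ ^ 2) = fun ξ => F ξ * fderiv ℝ F ξ ξ := by
    ext ξ
    by_cases hξ : ξ = 0
    · simp [hξ, hF.map_zero]
    · rw [hF.fderiv_apply_self hξ, sq]
  rw [e]
  exact hF.measurable_mul_fderiv.comp (measurable_id.prodMk measurable_id)

theorem exists_abs_mul_fderiv_le (hF : IsFinslerNorm F) : ∃ C, 0 < C ∧
    ∀ ξ V : Euc N, |F ξ * fderiv ℝ F ξ V| ≤ C * (F ξ * ‖V‖) := by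
  obtain ⟨C, hC, h⟩ := hF.exists_bound
  refine ⟨C, hC, fun ξ V => ?_⟩
  by_cases hξ : ξ = 0
  · simp [hξ, hF.map_zero]
  · rw [abs_mul, abs_of_nonneg (hF.nonneg ξ)]
    have := (fderiv ℝ F ξ).le_of_opNorm_le (h ξ hξ).1 V
    rw [Real.norm_eq_abs] at this
    nlinarith [mul_le_mul_of_nonneg_left this (hF.nonneg ξ)]

theorem exists_supportFn_bounds (hF : IsFinslerNorm F) : ∃ c C : ℝ, 0 < c ∧ c ≤ C ∧
    ∀ x : Euc N, c * ‖x‖ ≤ supportFn F x ∧ supportFn F x ≤ C * ‖x‖ := by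
  obtain ⟨a, b, ha, hab, h⟩ := hF.comparable
  have hb : 0 < b := ha.trans_le hab
  have hub : ∀ x : Euc N, ∀ y ∈ (fun ξ : Euc N => inner ℝ x ξ) '' {ξ | F ξ < 1}, y ≤ a⁻¹ * ‖x‖ := by
    rintro x _ ⟨ξ, hξ, rfl⟩
    have hξ : F ξ < 1 := hξ
    have h1 : ‖ξ‖ ≤ a⁻¹ := by
      rw [← one_div, le_div_iff₀ ha]
      linarith [(h ξ).1]
    calc inner ℝ x ξ ≤ ‖x‖ * ‖ξ‖ := real_inner_le_norm _ _
      _ ≤ ‖x‖ * a⁻¹ := mul_le_mul_of_nonneg_left h1 (norm_nonneg _)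
      _ = _ := mul_comm _ _
  refine ⟨(2 * b)⁻¹, a⁻¹, by positivity, inv_anti₀ ha (by linarith), fun x => ⟨?_, ?_⟩⟩
  -- The witness `x / (2b‖x‖)` has `F ≤ 1/2`. For `x = 0` the convention `0⁻¹ = 0` makes it the
  -- origin.
  · refine le_csSup ⟨_, hub x⟩ ⟨((2 * b)⁻¹ * ‖x‖⁻¹) • x, ?_, ?_⟩
    · have h1 := (h (((2 * b)⁻¹ * ‖x‖⁻¹) • x)).2
      rw [norm_smul, Real.norm_of_nonneg (by positivity)] at h1
      refine h1.trans_lt ?_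
      by_cases hx : ‖x‖ = 0
      · simp [hx]
      · rw [mul_assoc, inv_mul_cancel₀ hx]
        field_simp
        norm_num
    · simp only [inner_smul_right, real_inner_self_eq_norm_sq]
      by_cases hx : ‖x‖ = 0
      · simp [hx]
      · field_simp
  · refine csSup_le ⟨_, 0, ?_, rfl⟩ (hub x)
    simp [hF.map_zero]

end IsFinslerNorm

/-! ### Fatou's lemma and calculus of test functions. -/

/-- Fatou's lemma for nonnegative integrable functions. -/
theorem integrable_and_integral_le_of_tendsto {X : Type*} [MeasurableSpace X] {μ : Measure X}
    {k : ℕ → X → ℝ} {k₀ : X → ℝ} {I : ℕ → ℝ} {I₀ : ℝ} (hk : ∀ n, Integrable (k n) μ)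
    (hk0 : ∀ n x, 0 ≤ k n x) (hae : ∀ᵐ x ∂μ, Tendsto (fun n => k n x) atTop (𝓝 (k₀ x)))
    (hI : ∀ n, ∫ x, k n x ∂μ ≤ I n) (hI₀ : Tendsto I atTop (𝓝 I₀)) :
    Integrable k₀ μ ∧ ∫ x, k₀ x ∂μ ≤ I₀ := by
  have hm₀ : AEStronglyMeasurable k₀ μ := aestronglyMeasurable_of_tendsto_ae _ (fun n => (hk n).1) hae
  have hk₀ : 0 ≤ᵐ[μ] k₀ := by
    filter_upwards [hae] with x hx
    exact ge_of_tendsto' hx fun n => hk0 n x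
  have hI₀0 : 0 ≤ I₀ := ge_of_tendsto' hI₀ fun n => (integral_nonneg (hk0 n)).trans (hI n)
  have h1 : ∫⁻ x, ENNReal.ofReal (k₀ x) ∂μ ≤ ENNReal.ofReal I₀ := by
    calc ∫⁻ x, ENNReal.ofReal (k₀ x) ∂μ
        = ∫⁻ x, liminf (fun n => ENNReal.ofReal (k n x)) atTop ∂μ := by
          refine lintegral_congr_ae ?_
          filter_upwards [hae] with x hx
          exact ((ENNReal.continuous_ofReal.tendsto _).comp hx).liminf_eq.symm
      _ ≤ liminf (fun n => ∫⁻ x, ENNReal.ofReal (k n x) ∂μ) atTop :=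
          lintegral_liminf_le' fun n => (hk n).1.aemeasurable.ennreal_ofReal
      _ ≤ liminf (fun n => ENNReal.ofReal (I n)) atTop := by
          refine liminf_le_liminf (Eventually.of_forall fun n => ?_)
          rw [← ofReal_integral_eq_lintegral_ofReal (hk n) (Eventually.of_forall (hk0 n))]
          exact ENNReal.ofReal_le_ofReal (hI n)
      _ = ENNReal.ofReal I₀ := ((ENNReal.continuous_ofReal.tendsto _).comp hI₀).liminf_eq
  have hi : Integrable k₀ μ := by
    refine ⟨hm₀, ?_⟩
    rw [hasFiniteIntegral_iff_ofReal hk₀]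
    exact h1.trans_lt ENNReal.ofReal_lt_top
  refine ⟨hi, ?_⟩
  rw [← ofReal_integral_eq_lintegral_ofReal hi hk₀] at h1
  exact (ENNReal.ofReal_le_ofReal_iff hI₀0).1 h1

section TestFunctions

variable {N : ℕ}

theorem ContDiff.continuous_gradient {v : Euc N → ℝ} (hv : ContDiff ℝ ∞ v) :
    Continuous (gradient v) :=
  (InnerProductSpace.toDual ℝ (Euc N)).symm.continuous.comp (hv.continuous_fderiv (by simp))

theorem gradient_eq_zero_of_notMem_tsupport {φ : Euc N → ℝ} {x : Euc N} (hx : x ∉ tsupport φ) :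
    gradient φ x = 0 := by
  have : fderiv ℝ φ x = 0 := by
    by_contra h
    exact hx (support_fderiv_subset ℝ h)
  rw [gradient, this, map_zero]

theorem IsTestFunction.hasCompactSupport_gradient {φ : Euc N → ℝ} (hφ : IsTestFunction φ) :
    HasCompactSupport (gradient φ) :=
  HasCompactSupport.intro hφ.2 fun {_} hx => gradient_eq_zero_of_notMem_tsupport hx

theorem IsTestFunction.exists_bounds {φ : Euc N → ℝ} (hφ : IsTestFunction φ) :
    ∃ r K : ℝ, 0 ≤ K ∧ ∀ x, |φ x| ≤ K ∧ ‖gradient φ x‖ ≤ K ∧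
      (r < ‖x‖ → φ x = 0 ∧ gradient φ x = 0) := by
  obtain ⟨K₁, h₁⟩ := hφ.2.exists_bound_of_continuous hφ.1.continuous
  obtain ⟨K₂, h₂⟩ := hφ.hasCompactSupport_gradient.exists_bound_of_continuous hφ.1.continuous_gradient
  obtain ⟨r, hr⟩ := hφ.2.isBounded.subset_closedBall (0 : Euc N)
  refine ⟨r, max K₁ K₂, (norm_nonneg (φ 0)).trans ((h₁ 0).trans (le_max_left _ _)),
    fun x => ⟨(h₁ x).trans (le_max_left _ _), (h₂ x).trans (le_max_right _ _), fun hx => ?_⟩⟩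
  have hx' : x ∉ tsupport φ := fun h => by
    have := hr h
    rw [mem_closedBall_zero_iff] at this
    linarith
  exact ⟨image_eq_zero_of_notMem_tsupport hx', gradient_eq_zero_of_notMem_tsupport hx'⟩

theorem IsTestFunction.comp_mul {φ : Euc N → ℝ} (hφ : IsTestFunction φ) {κ : ℝ → ℝ}
    (hκ : ContDiff ℝ ∞ κ) {v : Euc N → ℝ} (hv : ContDiff ℝ ∞ v) :
    IsTestFunction fun x => κ (v x) * φ x :=
  ⟨(hκ.comp hv).mul hφ.1, hφ.2.mul_left⟩

theorem gradient_comp_mul {φ : Euc N → ℝ} (hφ : ContDiff ℝ ∞ φ) {κ : ℝ → ℝ}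
    (hκ : ContDiff ℝ ∞ κ) {v : Euc N → ℝ} (hv : ContDiff ℝ ∞ v) (x : Euc N) :
    gradient (fun x => κ (v x) * φ x) x =
      (deriv κ (v x) * φ x) • gradient v x + κ (v x) • gradient φ x := by
  have h1 := ((hκ.differentiable (by simp)) (v x)).hasDerivAt.comp_hasFDerivAt x
    (hv.differentiable (by simp) x).hasFDerivAt
  have h2 := (h1.mul (hφ.differentiable (by simp) x).hasFDerivAt).fderiv
  have h3 : gradient (fun x => κ (v x) * φ x) x =
      (InnerProductSpace.toDual ℝ (Euc N)).symm (fderiv ℝ ((κ ∘ v) * φ) x) := rfl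
  rw [h3, h2]
  simp only [map_add, map_smul, gradient, Function.comp_apply, smul_smul, mul_comm]
  rw [add_comm]

end TestFunctions

/-! ### Testing with functions of `u`. -/

section Testing

variable {N : ℕ} {F : Euc N → ℝ} {u : Euc N → ℝ} {G : Euc N → Euc N}

/-- The weak equation may be tested with `κ(u) φ`. -/
theorem weak_eq_comp_mul (hF : IsFinslerNorm F) (hu : IsH1LocWithGradient u G)
    {g : Euc N → ℝ} (hg : LocallyIntegrable g)
    (hw : ∀ φ : Euc N → ℝ, IsTestFunction φ →
      ∫ x, F (G x) * fderiv ℝ F (G x) (gradient φ x) = ∫ x, g x * φ x)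
    {κ : ℝ → ℝ} (hκ : ContDiff ℝ ∞ κ) {M : ℝ} (hκM : ∀ t, |κ t| ≤ M) (hκM' : ∀ t, |deriv κ t| ≤ M)
    {φ : Euc N → ℝ} (hφ : IsTestFunction φ) :
    ∫ x, F (G x) * fderiv ℝ F (G x) ((deriv κ (u x) * φ x) • G x + κ (u x) • gradient φ x) =
      ∫ x, g x * (κ (u x) * φ x) := by
  obtain ⟨v, hv, hvu, hvG, hlim⟩ := hu.exists_smooth_approx
  obtain ⟨r, K, hK, hφb⟩ := hφ.exists_bounds
  obtain ⟨C, hC, hCb⟩ := hF.exists_abs_mul_fderiv_le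
  obtain ⟨a, b, ha, hab, hab'⟩ := hF.comparable
  have hb : 0 < b := ha.trans_le hab
  have hM : 0 ≤ M := (abs_nonneg _).trans (hκM 0)
  have hκc' : Continuous (deriv κ) := hκ.continuous_deriv (by simp)
  have hL := hlim r (C * b * (2 * M * K))
    (fun n x => F (G x) * fderiv ℝ F (G x) (gradient (fun x => κ (v n x) * φ x) x))
    (fun x => F (G x) * fderiv ℝ F (G x)
      ((deriv κ (u x) * φ x) • G x + κ (u x) • gradient φ x)) ?_ ?_ ?_ ?_
  -- Here `g` is only locally integrable, so boundedness of `κ` is essential.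
  · have hR : Tendsto (fun n => ∫ x, g x * (κ (v n x) * φ x)) atTop
        (𝓝 (∫ x, g x * (κ (u x) * φ x))) := by
      refine tendsto_integral_of_dominated_convergence (fun x => M * |φ x • g x|) (fun n => ?_)
        ((hg.integrable_smul_left_of_hasCompactSupport hφ.1.continuous hφ.2).abs.const_mul M)
        (fun n => Eventually.of_forall fun x => ?_) ?_
      · exact hg.aestronglyMeasurable.mul
          ((hκ.continuous.comp (hv n).continuous).mul hφ.1.continuous).aestronglyMeasurable
      · rw [Real.norm_eq_abs, smul_eq_mul, abs_mul, abs_mul, abs_mul]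
        calc |g x| * (|κ (v n x)| * |φ x|) ≤ |g x| * (M * |φ x|) := by gcongr; exact hκM _
          _ = _ := by ring
      · filter_upwards [hvu] with x hx
        exact (((hκ.continuous.tendsto _).comp hx).mul_const _).const_mul _
    refine tendsto_nhds_unique hL (hR.congr fun n => ?_)
    exact (hw _ (hφ.comp_mul hκ (hv n))).symm
  · intro n
    exact (hF.measurable_mul_fderiv.comp_aemeasurable
      (hu.memL2Loc_gradient.locallyIntegrable.aestronglyMeasurable.aemeasurable.prodMk
        (hφ.comp_mul hκ (hv n)).1.continuous_gradient.measurable.aemeasurable)).aestronglyMeasurable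
  · filter_upwards [hvu, hvG] with x hx hx'
    simp only [gradient_comp_mul hφ.1 hκ (hv _)]
    refine Tendsto.const_mul _ (((fderiv ℝ F (G x)).continuous.tendsto _).comp ?_)
    exact ((((hκc'.tendsto _).comp hx).mul_const _).smul hx').add
      (((hκ.continuous.tendsto _).comp hx).smul_const _)
  · intro n x hx
    obtain ⟨h1, h2⟩ := (hφb x).2.2 hx
    simp only [gradient_comp_mul hφ.1 hκ (hv _), h1, h2]
    simp
  · intro n x
    simp only [gradient_comp_mul hφ.1 hκ (hv _)]
    refine (hCb _ _).trans ?_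
    have e1 : ‖(deriv κ (v n x) * φ x) • gradient (v n) x + κ (v n x) • gradient φ x‖ ≤
        M * K * (‖gradient (v n) x‖ + 1) := by
      refine (norm_add_le _ _).trans ?_
      rw [norm_smul, norm_smul, Real.norm_eq_abs, Real.norm_eq_abs, abs_mul, mul_add, mul_one]
      gcongr
      · exact hκM' _
      · exact (hφb x).1
      · exact hκM _
      · exact (hφb x).2.1
    have e2 : F (G x) * ‖(deriv κ (v n x) * φ x) • gradient (v n) x + κ (v n x) • gradient φ x‖ ≤
        (b * ‖G x‖) * (M * K * (‖gradient (v n) x‖ + 1)) :=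
      mul_le_mul (hab' _).2 e1 (norm_nonneg _) (by positivity)
    have e3 : ‖G x‖ * (‖gradient (v n) x‖ + 1) ≤
        2 * (1 + u x ^ 2 + ‖G x‖ ^ 2 + v n x ^ 2 + ‖gradient (v n) x‖ ^ 2) := by
      nlinarith [sq_nonneg (‖G x‖ - ‖gradient (v n) x‖), sq_nonneg (‖G x‖ - 1), sq_nonneg (u x),
        sq_nonneg (v n x), sq_nonneg (‖G x‖), sq_nonneg ‖gradient (v n) x‖]
    calc _ ≤ C * ((b * ‖G x‖) * (M * K * (‖gradient (v n) x‖ + 1))) :=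
          mul_le_mul_of_nonneg_left e2 hC.le
      _ = C * b * (M * K) * (‖G x‖ * (‖gradient (v n) x‖ + 1)) := by ring
      _ ≤ C * b * (M * K) *
          (2 * (1 + u x ^ 2 + ‖G x‖ ^ 2 + v n x ^ 2 + ‖gradient (v n) x‖ ^ 2)) :=
          mul_le_mul_of_nonneg_left e3 (by positivity)
      _ = _ := by ring

/-- The stability inequality may be tested with `ζ(u) φ`, where `ζ` may grow linearly. -/
theorem stability_comp_mul (hF : IsFinslerNorm F) (hN : 2 ≤ N) (hu : IsH1LocWithGradient u G)
    {g : Euc N → ℝ} (hg : LocallyIntegrable g) (hg0 : ∀ x, 0 ≤ g x)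
    (hs : ∀ φ : Euc N → ℝ, IsTestFunction φ →
      0 ≤ ∫ x, (energyHessianExt F (G x) (gradient φ x) - g x * φ x ^ 2))
    {ζ : ℝ → ℝ} (hζ : ContDiff ℝ ∞ ζ) {M : ℝ} (hζM : ∀ t, |ζ t| ≤ M * (1 + |t|))
    (hζM' : ∀ t, |deriv ζ t| ≤ M) {φ : Euc N → ℝ} (hφ : IsTestFunction φ) :
    Integrable (fun x => g x * (ζ (u x) * φ x) ^ 2) ∧
    ∫ x, g x * (ζ (u x) * φ x) ^ 2 ≤
      ∫ x, energyHessianExt F (G x) ((deriv ζ (u x) * φ x) • G x + ζ (u x) • gradient φ x) := by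
  obtain ⟨v, hv, hvu, hvG, hlim⟩ := hu.exists_smooth_approx
  obtain ⟨r, K, hK, hφb⟩ := hφ.exists_bounds
  obtain ⟨C, hC, hCb⟩ := hF.exists_abs_energyHessianExt_le hN
  have hM : 0 ≤ M := (abs_nonneg _).trans (hζM' 0)
  have hζc' : Continuous (deriv ζ) := hζ.continuous_deriv (by simp)
  have hm : ∀ {ψ : Euc N → ℝ}, IsTestFunction ψ →
      AEStronglyMeasurable (fun x => energyHessianExt F (G x) (gradient ψ x)) := fun hψ =>
    ((hF.measurable_energyHessianExt hN).comp_aemeasurable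
      (hu.memL2Loc_gradient.locallyIntegrable.aestronglyMeasurable.aemeasurable.prodMk
        hψ.1.continuous_gradient.measurable.aemeasurable)).aestronglyMeasurable
  have hgi : ∀ {ψ : Euc N → ℝ}, IsTestFunction ψ → Integrable (fun x => g x * ψ x ^ 2) := by
    intro ψ hψ
    have := hg.integrable_smul_left_of_hasCompactSupport (g := fun x => ψ x * ψ x)
      (hψ.1.continuous.mul hψ.1.continuous) hψ.2.mul_left
    refine this.congr (Eventually.of_forall fun x => ?_)
    simp only [smul_eq_mul]
    ring
  have hBi : ∀ {ψ : Euc N → ℝ}, IsTestFunction ψ →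
      Integrable (fun x => energyHessianExt F (G x) (gradient ψ x)) := by
    intro ψ hψ
    obtain ⟨r', K', hK', hψb⟩ := hψ.exists_bounds
    have hi : Integrable ((Metric.closedBall (0 : Euc N) r').indicator fun _ => C * K' ^ 2) := by
      rw [integrable_indicator_iff Metric.isClosed_closedBall.measurableSet]
      exact integrableOn_const (isCompact_closedBall _ _).measure_lt_top.ne
    refine hi.mono' (hm hψ) (Eventually.of_forall fun x => ?_)
    rw [Real.norm_eq_abs]
    refine (hCb _ _).trans ?_
    by_cases hx : ‖x‖ ≤ r'
    · rw [Set.indicator_of_mem (by simpa using hx)]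
      gcongr
      exact (hψb x).2.1
    · rw [((hψb x).2.2 (not_le.1 hx)).2, Set.indicator_of_notMem (by simpa using hx)]
      simp
  have hL := hlim r (C * (3 * (M * K) ^ 2))
    (fun n x => energyHessianExt F (G x) (gradient (fun x => ζ (v n x) * φ x) x))
    (fun x => energyHessianExt F (G x)
      ((deriv ζ (u x) * φ x) • G x + ζ (u x) • gradient φ x)) ?_ ?_ ?_ ?_
  -- With `ζ` unbounded and `g` only in `L¹_loc`, the left side passes to the limit by Fatou only.
  -- This is the right direction, and it yields integrability as well.
  · refine integrable_and_integral_le_of_tendsto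
      (fun n => hgi (hφ.comp_mul hζ (hv n))) (fun n x => mul_nonneg (hg0 x) (sq_nonneg _))
      ?_ (fun n => ?_) hL
    · filter_upwards [hvu] with x hx
      exact ((((hζ.continuous.tendsto _).comp hx).mul_const _).pow 2).const_mul _
    · have h1 := hs _ (hφ.comp_mul hζ (hv n))
      rw [integral_sub (hBi (hφ.comp_mul hζ (hv n))) (hgi (hφ.comp_mul hζ (hv n)))] at h1
      linarith
  · exact fun n => hm (hφ.comp_mul hζ (hv n))
  · filter_upwards [hvu, hvG] with x hx hx'
    simp only [gradient_comp_mul hφ.1 hζ (hv _)]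
    refine ((hF.continuous_energyHessianExt hN (G x)).tendsto _).comp ?_
    exact ((((hζc'.tendsto _).comp hx).mul_const _).smul hx').add
      (((hζ.continuous.tendsto _).comp hx).smul_const _)
  · intro n x hx
    obtain ⟨h1, h2⟩ := (hφb x).2.2 hx
    simp only [gradient_comp_mul hφ.1 hζ (hv _), h1, h2]
    simpa using IsFinslerNorm.energyHessianExt_zero_right hN _
  · intro n x
    simp only [gradient_comp_mul hφ.1 hζ (hv _)]
    refine (hCb _ _).trans ?_
    have e1 : ‖(deriv ζ (v n x) * φ x) • gradient (v n) x + ζ (v n x) • gradient φ x‖ ≤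
        M * K * (‖gradient (v n) x‖ + 1 + |v n x|) := by
      refine (norm_add_le _ _).trans ?_
      rw [norm_smul, norm_smul, Real.norm_eq_abs, Real.norm_eq_abs, abs_mul]
      calc |deriv ζ (v n x)| * |φ x| * ‖gradient (v n) x‖ + |ζ (v n x)| * ‖gradient φ x‖
          ≤ M * K * ‖gradient (v n) x‖ + M * (1 + |v n x|) * K := by
            gcongr
            · exact hζM' _
            · exact (hφb x).1
            · exact hζM _
            · exact (hφb x).2.1
        _ = _ := by ring
    have e2 := pow_le_pow_left₀ (norm_nonneg _) e1 2
    have e3 : (‖gradient (v n) x‖ + 1 + |v n x|) ^ 2 ≤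
        3 * (1 + u x ^ 2 + ‖G x‖ ^ 2 + v n x ^ 2 + ‖gradient (v n) x‖ ^ 2) := by
      rw [← sq_abs (v n x)]
      nlinarith [sq_nonneg (‖gradient (v n) x‖ - 1), sq_nonneg (‖gradient (v n) x‖ - |v n x|),
        sq_nonneg (|v n x| - 1), sq_nonneg (u x), sq_nonneg ‖G x‖]
    calc _ ≤ C * (M * K * (‖gradient (v n) x‖ + 1 + |v n x|)) ^ 2 :=
          mul_le_mul_of_nonneg_left e2 hC.le
      _ = C * (M * K) ^ 2 * (‖gradient (v n) x‖ + 1 + |v n x|) ^ 2 := by ring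
      _ ≤ C * (M * K) ^ 2 *
          (3 * (1 + u x ^ 2 + ‖G x‖ ^ 2 + v n x ^ 2 + ‖gradient (v n) x‖ ^ 2)) :=
          mul_le_mul_of_nonneg_left e3 (by positivity)
      _ = _ := by ring

end Testing

/-! ### Substitutes for the exponential with linear growth. -/

section CutoffExponential

/-- The logistic function of `p t / 2`. -/
noncomputable def logistic (p t : ℝ) : ℝ := Real.exp (p / 2 * t) / (1 + Real.exp (p / 2 * t))

/-- A function behaving like `exp (p t / 2)` at `-∞` and growing linearly at `+∞`. -/
noncomputable def softplus (p t : ℝ) : ℝ := Real.log (1 + Real.exp (p / 2 * t))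

/-- The primitive of `p * logistic p ^ 2` vanishing at `-∞`. -/
noncomputable def fluxWeight (p t : ℝ) : ℝ := 2 * (softplus p t - logistic p t)

/-- Bounded approximations of `fluxWeight p` from below. -/
noncomputable def cutFluxWeight (p ε t : ℝ) : ℝ := fluxWeight p t / (1 + ε * fluxWeight p t)

variable {p : ℝ}

theorem contDiff_softplus (p : ℝ) : ContDiff ℝ ∞ (softplus p) :=
  (contDiff_const.add (Real.contDiff_exp.comp (contDiff_const.mul contDiff_id))).log
    fun t => (by positivity : 1 + Real.exp (p / 2 * t) ≠ 0)

theorem contDiff_logistic (p : ℝ) : ContDiff ℝ ∞ (logistic p) := by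
  have h : ContDiff ℝ ∞ fun t : ℝ => Real.exp (p / 2 * t) :=
    Real.contDiff_exp.comp (contDiff_const.mul contDiff_id)
  exact h.div (contDiff_const.add h) fun t => by positivity

theorem contDiff_fluxWeight (p : ℝ) : ContDiff ℝ ∞ (fluxWeight p) :=
  contDiff_const.mul ((contDiff_softplus p).sub (contDiff_logistic p))

theorem hasDerivAt_softplus (p t : ℝ) : HasDerivAt (softplus p) (p / 2 * logistic p t) t := by
  have h1 : HasDerivAt (fun t : ℝ => 1 + Real.exp (p / 2 * t)) _ t :=
    ((hasDerivAt_id t).const_mul (p / 2)).exp.const_add 1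
  have h2 : 1 + Real.exp (p / 2 * t) ≠ 0 := by positivity
  refine (h1.log h2).congr_deriv ?_
  simp only [logistic, id_eq]
  ring

theorem hasDerivAt_logistic (p t : ℝ) :
    HasDerivAt (logistic p) (p / 2 * (logistic p t - logistic p t ^ 2)) t := by
  have h0 : HasDerivAt (fun t : ℝ => Real.exp (p / 2 * t)) _ t :=
    ((hasDerivAt_id t).const_mul (p / 2)).exp
  have h2 : (1 + Real.exp (p / 2 * t)) ≠ 0 := by positivity
  refine (h0.div (h0.const_add 1) h2).congr_deriv ?_
  simp only [logistic, id_eq]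
  field_simp

/-- The derivative equals `(4/p) (softplus')²`, so the equation and the stability inequality produce
the same gradient integral, with constants `p` and `p²/4`. -/
theorem hasDerivAt_fluxWeight (p t : ℝ) :
    HasDerivAt (fluxWeight p) (p * logistic p t ^ 2) t := by
  refine (((hasDerivAt_softplus p t).sub (hasDerivAt_logistic p t)).const_mul 2).congr_deriv ?_
  ring

theorem logistic_pos (p t : ℝ) : 0 < logistic p t := by
  unfold logistic; positivity

theorem logistic_le_one (p t : ℝ) : logistic p t ≤ 1 := by
  unfold logistic
  rw [div_le_one (by positivity)]
  linarith

theorem softplus_pos (p t : ℝ) : 0 < softplus p t :=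
  Real.log_pos (by linarith [Real.exp_pos (p / 2 * t)])

theorem softplus_le_exp (p t : ℝ) : softplus p t ≤ Real.exp (p / 2 * t) := by
  have := Real.log_le_sub_one_of_pos (x := 1 + Real.exp (p / 2 * t)) (by positivity)
  unfold softplus
  linarith

theorem softplus_le (hp : 0 ≤ p) (t : ℝ) : softplus p t ≤ (1 + p / 2) * (1 + |t|) := by
  have h1 : 1 + Real.exp (p / 2 * t) ≤ Real.exp (1 + p / 2 * |t|) := by
    rw [Real.exp_add]
    have h2 : Real.exp (p / 2 * t) ≤ Real.exp (p / 2 * |t|) :=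
      Real.exp_le_exp.2 (mul_le_mul_of_nonneg_left (le_abs_self t) (by positivity))
    have h3 : 1 ≤ Real.exp (p / 2 * |t|) := Real.one_le_exp (by positivity)
    have h4 : (2 : ℝ) ≤ Real.exp 1 := by linarith [Real.add_one_le_exp (1 : ℝ)]
    nlinarith
  have h5 := Real.log_le_log (by positivity) h1
  rw [Real.log_exp] at h5
  unfold softplus
  nlinarith [abs_nonneg t]

/-- Writing `L` for `softplus`, this turns comparisons with `fluxWeight = 2 (L - 1 + e^{-L})` into
one-variable inequalities in `L > 0`. -/
theorem logistic_eq (p t : ℝ) : logistic p t = 1 - Real.exp (-softplus p t) := by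
  have : (0 : ℝ) < 1 + Real.exp (p / 2 * t) := by positivity
  rw [softplus, Real.exp_neg, Real.exp_log this, logistic]
  field_simp
  ring

theorem logistic_le_softplus (p t : ℝ) : logistic p t ≤ softplus p t := by
  rw [logistic_eq]
  linarith [Real.add_one_le_exp (-softplus p t)]

theorem fluxWeight_nonneg (p t : ℝ) : 0 ≤ fluxWeight p t :=
  mul_nonneg zero_le_two (sub_nonneg.2 (logistic_le_softplus p t))

/-- Amounts to `e^{-L} ≤ 1 - L + L²/2`. It bounds the right-hand side of the tested equation by the
quantity that stability controls, with constant one. -/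
theorem fluxWeight_le_sq (p t : ℝ) : fluxWeight p t ≤ softplus p t ^ 2 := by
  rw [fluxWeight, logistic_eq]
  set L := softplus p t
  have hL : 0 < L := softplus_pos p t
  -- Since `(1 + L + L²/2)(1 - L + L²/2) = 1 + L⁴/4 ≥ 1`, the lower bound for `e^L` gives the upper
  -- bound for `e^{-L}`.
  have h1 := Real.quadratic_le_exp_of_nonneg hL.le
  have h2 : 1 ≤ Real.exp L * (1 - L + L ^ 2 / 2) := by
    have h3 : 0 < 1 - L + L ^ 2 / 2 := by nlinarith [sq_nonneg (L - 1)]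
    nlinarith [mul_le_mul_of_nonneg_right h1 h3.le, sq_nonneg (L ^ 2)]
  have h4 : Real.exp (-L) ≤ 1 - L + L ^ 2 / 2 := by
    rw [Real.exp_neg, inv_le_iff_one_le_mul₀ (Real.exp_pos L), mul_comm]
    exact h2
  linarith

/-- Splits the weight in the flux term so that Young's inequality gives an absorbable `logistic² F²`
part and a `softplus² |∇φ|²` part. It reduces to `softplus ≤ e^{pt/2}`. -/
theorem fluxWeight_le_mul (p t : ℝ) : fluxWeight p t ≤ 2 * (softplus p t * logistic p t) := by
  have h0 : (0 : ℝ) < 1 + Real.exp (p / 2 * t) := by positivity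
  have h1 : softplus p t * (1 - logistic p t) ≤ logistic p t := by
    have h2 : 1 - logistic p t = (1 + Real.exp (p / 2 * t))⁻¹ := by
      unfold logistic; field_simp; ring
    rw [h2, ← div_eq_mul_inv, logistic]
    exact div_le_div_of_nonneg_right (softplus_le_exp p t) h0.le
  rw [fluxWeight]
  linarith

variable {ε : ℝ}

theorem one_le_one_add_mul_fluxWeight (p : ℝ) (hε : 0 ≤ ε) (t : ℝ) :
    1 ≤ 1 + ε * fluxWeight p t := by
  linarith [mul_nonneg hε (fluxWeight_nonneg p t)]

theorem contDiff_cutFluxWeight (p : ℝ) (hε : 0 ≤ ε) : ContDiff ℝ ∞ (cutFluxWeight p ε) :=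
  (contDiff_fluxWeight p).div (contDiff_const.add (contDiff_const.mul (contDiff_fluxWeight p)))
    fun t => by linarith [one_le_one_add_mul_fluxWeight p hε t]

theorem deriv_cutFluxWeight (p : ℝ) (hε : 0 ≤ ε) (t : ℝ) : deriv (cutFluxWeight p ε) t =
    p * (logistic p t ^ 2 / (1 + ε * fluxWeight p t) ^ 2) := by
  have h1 := hasDerivAt_fluxWeight p t
  have h2 : 1 + ε * fluxWeight p t ≠ 0 := by linarith [one_le_one_add_mul_fluxWeight p hε t]
  have h3 := (h1.div ((h1.const_mul ε).const_add 1) h2).deriv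
  refine h3.trans ?_
  field_simp
  ring

theorem cutFluxWeight_nonneg (p : ℝ) (hε : 0 ≤ ε) (t : ℝ) : 0 ≤ cutFluxWeight p ε t :=
  div_nonneg (fluxWeight_nonneg p t) (by linarith [one_le_one_add_mul_fluxWeight p hε t])

theorem cutFluxWeight_le (p : ℝ) (hε : 0 ≤ ε) (t : ℝ) : cutFluxWeight p ε t ≤ fluxWeight p t :=
  div_le_self (fluxWeight_nonneg p t) (one_le_one_add_mul_fluxWeight p hε t)

theorem cutFluxWeight_le_inv (p : ℝ) (hε : 0 < ε) (t : ℝ) : cutFluxWeight p ε t ≤ ε⁻¹ := by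
  have h := one_le_one_add_mul_fluxWeight p hε.le t
  rw [cutFluxWeight, div_le_iff₀ (by linarith), mul_add, inv_mul_cancel_left₀ hε.ne']
  linarith [inv_pos.2 hε]

theorem logistic_sq_div_le (p : ℝ) (hε : 0 ≤ ε) (t : ℝ) :
    logistic p t ^ 2 / (1 + ε * fluxWeight p t) ^ 2 ≤ logistic p t ^ 2 :=
  div_le_self (sq_nonneg _) (one_le_pow₀ (one_le_one_add_mul_fluxWeight p hε t))

theorem abs_deriv_cutFluxWeight_le (hp : 0 ≤ p) (hε : 0 ≤ ε) (t : ℝ) :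
    |deriv (cutFluxWeight p ε) t| ≤ p := by
  rw [deriv_cutFluxWeight p hε, abs_of_nonneg (by positivity)]
  have h1 := logistic_sq_div_le p hε t
  have h2 : logistic p t ^ 2 ≤ 1 := pow_le_one₀ (logistic_pos p t).le (logistic_le_one p t)
  nlinarith

end CutoffExponential

/-! ### The energy estimate from stability and the equation. -/

section EnergyEstimate

variable {N : ℕ} {F : Euc N → ℝ} {u : Euc N → ℝ} {G : Euc N → Euc N} {p : ℝ}

theorem integrable_softplus_sq_mul (hu : IsH1LocWithGradient u G) (hp : 0 ≤ p) {φ : Euc N → ℝ}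
    (hφ : IsTestFunction φ) : Integrable fun x => softplus p (u x) ^ 2 * ‖gradient φ x‖ ^ 2 := by
  have hul : LocallyIntegrable fun x => 1 + ‖u x‖ ^ 2 :=
    (locallyIntegrable_const 1).add hu.memL2Loc.locallyIntegrable_norm_sq
  have hum := hu.memL2Loc.locallyIntegrable.aestronglyMeasurable
  have hi := (hul.integrable_smul_left_of_hasCompactSupport
    (g := fun x => ‖gradient φ x‖ ^ 2) (hφ.1.continuous_gradient.norm.pow 2)
    (hφ.hasCompactSupport_gradient.comp_left (g := fun v => ‖v‖ ^ 2) (by simp))).const_mul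
      (2 * (1 + p / 2) ^ 2)
  refine hi.mono' ((((contDiff_softplus p).continuous.comp_aestronglyMeasurable hum).pow 2).mul
    (hφ.1.continuous_gradient.norm.pow 2).aestronglyMeasurable)
    (Eventually.of_forall fun x => ?_)
  rw [Real.norm_of_nonneg (by positivity), smul_eq_mul, Real.norm_eq_abs]
  have h1 := pow_le_pow_left₀ (softplus_pos p (u x)).le (softplus_le hp (u x)) 2
  have h2 : (1 + |u x|) ^ 2 ≤ 2 * (1 + |u x| ^ 2) := by nlinarith [sq_nonneg (1 - |u x|)]
  have h3 : softplus p (u x) ^ 2 ≤ 2 * (1 + p / 2) ^ 2 * (1 + |u x| ^ 2) := by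
    rw [mul_pow] at h1
    nlinarith [sq_nonneg (1 + p / 2)]
  nlinarith [mul_le_mul_of_nonneg_right h3 (sq_nonneg ‖gradient φ x‖)]

theorem integrable_logistic_sq_mul (hF : IsFinslerNorm F) (hu : IsH1LocWithGradient u G)
    {φ : Euc N → ℝ} (hφ : IsTestFunction φ) {w : ℝ → ℝ} (hw : Continuous w)
    (hw1 : ∀ t, |w t| ≤ 1) : Integrable fun x => w (u x) * (φ x ^ 2 * F (G x) ^ 2) := by
  obtain ⟨a, b, ha, hab, hab'⟩ := hF.comparable
  have hG := hu.memL2Loc_gradient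
  have hi := (hG.locallyIntegrable_norm_sq.integrable_smul_left_of_hasCompactSupport
    (g := fun x => φ x * φ x) (hφ.1.continuous.mul hφ.1.continuous) hφ.2.mul_left).const_mul (b ^ 2)
  refine hi.mono' ((hw.comp_aestronglyMeasurable
    hu.memL2Loc.locallyIntegrable.aestronglyMeasurable).mul
    ((hφ.1.continuous.pow 2).aestronglyMeasurable.mul (hF.measurable_sq.comp_aemeasurable
      hG.locallyIntegrable.aestronglyMeasurable.aemeasurable).aestronglyMeasurable))
    (Eventually.of_forall fun x => ?_)
  rw [Real.norm_eq_abs, abs_mul, abs_of_nonneg (by positivity : 0 ≤ φ x ^ 2 * F (G x) ^ 2),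
    smul_eq_mul]
  have h1 := pow_le_pow_left₀ (hF.nonneg (G x)) (hab' (G x)).2 2
  calc |w (u x)| * (φ x ^ 2 * F (G x) ^ 2) ≤ 1 * (φ x ^ 2 * (b * ‖G x‖) ^ 2) := by
        gcongr
        exact hw1 _
    _ = _ := by ring

theorem gradient_mul_self {φ : Euc N → ℝ} (hφ : IsTestFunction φ) (x : Euc N) :
    gradient (fun x => φ x * φ x) x = (2 * φ x) • gradient φ x := by
  have := gradient_comp_mul hφ.1 contDiff_id hφ.1 x
  simp only [id_eq, deriv_id, one_mul] at this
  rw [this, two_mul, add_smul]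

theorem abs_cross_le {A B C δ : ℝ} (hδ : 0 < δ) : 2 * C * A * B ≤ δ * A ^ 2 + C ^ 2 / δ * B ^ 2 := by
  have h : δ * A ^ 2 + C ^ 2 / δ * B ^ 2 - 2 * C * A * B = (δ * A - C * B) ^ 2 / δ := by
    field_simp
    ring
  have : 0 ≤ (δ * A - C * B) ^ 2 / δ := by positivity
  linarith

/-- The weak equation, tested with `fluxWeight p u * φ²`. -/
theorem integral_logistic_sq_mul_le (hF : IsFinslerNorm F) (hp : 0 < p) {δ : ℝ} (hδ : 0 < δ) :
    ∃ C, 0 < C ∧ ∀ {u : Euc N → ℝ} {G : Euc N → Euc N} {g : Euc N → ℝ},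
      IsH1LocWithGradient u G → LocallyIntegrable g → (∀ x, 0 ≤ g x) →
      (∀ φ : Euc N → ℝ, IsTestFunction φ →
        ∫ x, F (G x) * fderiv ℝ F (G x) (gradient φ x) = ∫ x, g x * φ x) →
      ∀ {φ : Euc N → ℝ}, IsTestFunction φ →
      Integrable (fun x => g x * (softplus p (u x) * φ x) ^ 2) →
      p * ∫ x, logistic p (u x) ^ 2 * (φ x ^ 2 * F (G x) ^ 2) ≤
        (∫ x, g x * (softplus p (u x) * φ x) ^ 2) +
        (δ * (∫ x, logistic p (u x) ^ 2 * (φ x ^ 2 * F (G x) ^ 2)) +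
        C * ∫ x, softplus p (u x) ^ 2 * ‖gradient φ x‖ ^ 2) := by
  obtain ⟨C, hC, hCb⟩ := hF.exists_abs_mul_fderiv_le
  refine ⟨(2 * C) ^ 2 / δ, by positivity, fun {u G g} hu hg hg0 hw {φ} hφ hY => ?_⟩
  have hlog : ∀ t, |logistic p t ^ 2| ≤ 1 := fun t => by
    rw [abs_of_nonneg (sq_nonneg _)]
    exact pow_le_one₀ (logistic_pos p t).le (logistic_le_one p t)
  have hX := integrable_logistic_sq_mul hF hu hφ (w := fun t => logistic p t ^ 2)
    ((contDiff_logistic p).continuous.pow 2) hlog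
  have hZ := integrable_softplus_sq_mul hu hp.le hφ
  have hum := hu.memL2Loc.locallyIntegrable.aestronglyMeasurable
  have hGm := hu.memL2Loc_gradient.locallyIntegrable.aestronglyMeasurable
  have hφ2 : IsTestFunction fun x => φ x * φ x := ⟨hφ.1.mul hφ.1, hφ.2.mul_left⟩
  -- `fluxWeight` is unbounded, so the equation is tested with its bounded cut at `ε = 1/(n+1)`. The
  -- bound is uniform in `n`, and the left side then converges by domination.
  have key : ∀ n : ℕ, p * ∫ x, (logistic p (u x) ^ 2 /
      (1 + 1 / ((n : ℝ) + 1) * fluxWeight p (u x)) ^ 2) * (φ x ^ 2 * F (G x) ^ 2) ≤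
        (∫ x, g x * (softplus p (u x) * φ x) ^ 2) +
        (δ * (∫ x, logistic p (u x) ^ 2 * (φ x ^ 2 * F (G x) ^ 2)) +
        (2 * C) ^ 2 / δ * ∫ x, softplus p (u x) ^ 2 * ‖gradient φ x‖ ^ 2) := by
    intro n
    set ε : ℝ := 1 / ((n : ℝ) + 1) with hε_def
    have hε : 0 < ε := by positivity
    have hκ := contDiff_cutFluxWeight p hε.le
    have hW := weak_eq_comp_mul hF hu hg hw hκ (M := max ε⁻¹ p)
      (fun t => by
        rw [abs_of_nonneg (cutFluxWeight_nonneg p hε.le t)]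
        exact (cutFluxWeight_le_inv p hε t).trans (le_max_left _ _))
      (fun t => (abs_deriv_cutFluxWeight_le hp.le hε.le t).trans (le_max_right _ _)) hφ2
    have hflux : ∀ x, |cutFluxWeight p ε (u x) * (2 * φ x) *
        (F (G x) * fderiv ℝ F (G x) (gradient φ x))| ≤
        δ * (logistic p (u x) ^ 2 * (φ x ^ 2 * F (G x) ^ 2)) +
        (2 * C) ^ 2 / δ * (softplus p (u x) ^ 2 * ‖gradient φ x‖ ^ 2) := by
      intro x
      have h1 : cutFluxWeight p ε (u x) ≤ 2 * (softplus p (u x) * logistic p (u x)) :=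
        (cutFluxWeight_le p hε.le _).trans (fluxWeight_le_mul p _)
      have h2 := abs_cross_le (A := logistic p (u x) * |φ x| * F (G x))
        (B := softplus p (u x) * ‖gradient φ x‖) (C := 2 * C) hδ
      rw [abs_mul, abs_mul, abs_mul, abs_of_nonneg (cutFluxWeight_nonneg p hε.le _),
        abs_of_pos (zero_lt_two (α := ℝ))]
      have h3 := hF.nonneg (G x)
      have h4 := softplus_pos p (u x)
      have h5 := logistic_pos p (u x)
      calc _ ≤ 2 * (softplus p (u x) * logistic p (u x)) * (2 * |φ x|) *
            (C * (F (G x) * ‖gradient φ x‖)) := by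
            gcongr
            exact hCb _ _
        _ = 2 * (2 * C) * (logistic p (u x) * |φ x| * F (G x)) *
            (softplus p (u x) * ‖gradient φ x‖) := by ring
        _ ≤ _ := h2
        _ = _ := by rw [mul_pow, mul_pow, mul_pow, sq_abs]; ring
    have hI : ∀ x, F (G x) * fderiv ℝ F (G x) ((deriv (cutFluxWeight p ε) (u x) * (φ x * φ x)) • G x
        + cutFluxWeight p ε (u x) • gradient (fun x => φ x * φ x) x) =
        p * (logistic p (u x) ^ 2 / (1 + ε * fluxWeight p (u x)) ^ 2 *
          (φ x ^ 2 * F (G x) ^ 2)) +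
        cutFluxWeight p ε (u x) * (2 * φ x) *
          (F (G x) * fderiv ℝ F (G x) (gradient φ x)) := by
      intro x
      rw [gradient_mul_self hφ, deriv_cutFluxWeight p hε.le]
      by_cases hx : G x = 0
      · simp [hx, hF.map_zero]
      · simp only [map_add, map_smul, hF.fderiv_apply_self hx, smul_eq_mul]
        ring
    simp only [hI] at hW
    have i1 : Integrable fun x => logistic p (u x) ^ 2 / (1 + ε * fluxWeight p (u x)) ^ 2 *
        (φ x ^ 2 * F (G x) ^ 2) := by
      refine integrable_logistic_sq_mul hF hu hφ
        (w := fun t => logistic p t ^ 2 / (1 + ε * fluxWeight p t) ^ 2) ?_ fun t => ?_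
      · refine ((contDiff_logistic p).continuous.pow 2).div ((continuous_const.add
          (continuous_const.mul (contDiff_fluxWeight p).continuous)).pow 2) fun t => ?_
        have := one_le_one_add_mul_fluxWeight p hε.le t
        positivity
      · rw [abs_of_nonneg (by positivity)]
        exact (logistic_sq_div_le p hε.le t).trans ((le_abs_self _).trans (hlog t))
    have i2 : Integrable fun x => cutFluxWeight p ε (u x) * (2 * φ x) *
        (F (G x) * fderiv ℝ F (G x) (gradient φ x)) := by
      refine ((hX.const_mul δ).add (hZ.const_mul _)).mono' ?_ (Eventually.of_forall hflux)
      refine ((hκ.continuous.comp_aestronglyMeasurable hum).mul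
        (continuous_const.mul hφ.1.continuous).aestronglyMeasurable).mul ?_
      exact (hF.measurable_mul_fderiv.comp_aemeasurable (hGm.aemeasurable.prodMk
        hφ.1.continuous_gradient.measurable.aemeasurable)).aestronglyMeasurable
    rw [integral_add (i1.const_mul p) i2, integral_const_mul] at hW
    have hflux' := integral_mono i2.neg ((hX.const_mul δ).add (hZ.const_mul ((2 * C) ^ 2 / δ)))
      fun x => (neg_le_abs _).trans (hflux x)
    simp only [Pi.neg_apply, Pi.add_apply] at hflux'
    rw [integral_neg, integral_add (hX.const_mul δ) (hZ.const_mul _), integral_const_mul,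
      integral_const_mul] at hflux'
    have hR : ∫ x, g x * (cutFluxWeight p ε (u x) * (φ x * φ x)) ≤
        ∫ x, g x * (softplus p (u x) * φ x) ^ 2 := by
      refine integral_mono_of_nonneg (Eventually.of_forall fun x => ?_) hY
        (Eventually.of_forall fun x => ?_)
      · exact mul_nonneg (hg0 x) (mul_nonneg (cutFluxWeight_nonneg p hε.le _) (mul_self_nonneg _))
      · have := (cutFluxWeight_le p hε.le (u x)).trans (fluxWeight_le_sq p _)
        simp only
        rw [mul_pow, sq (φ x)]
        exact mul_le_mul_of_nonneg_left (mul_le_mul_of_nonneg_right this (mul_self_nonneg _))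
          (hg0 x)
    linarith
  suffices hT : Tendsto (fun n : ℕ => ∫ x, (logistic p (u x) ^ 2 /
      (1 + 1 / ((n : ℝ) + 1) * fluxWeight p (u x)) ^ 2) * (φ x ^ 2 * F (G x) ^ 2)) atTop
      (𝓝 (∫ x, logistic p (u x) ^ 2 * (φ x ^ 2 * F (G x) ^ 2))) from
    le_of_tendsto' (hT.const_mul p) key
  refine tendsto_integral_of_dominated_convergence
    (fun x => logistic p (u x) ^ 2 * (φ x ^ 2 * F (G x) ^ 2)) (fun n => ?_) hX
    (fun n => Eventually.of_forall fun x => ?_) (Eventually.of_forall fun x => ?_)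
  · have hc : Continuous fun t : ℝ =>
        logistic p t ^ 2 / (1 + 1 / ((n : ℝ) + 1) * fluxWeight p t) ^ 2 := by
      refine ((contDiff_logistic p).continuous.pow 2).div ((continuous_const.add
        (continuous_const.mul (contDiff_fluxWeight p).continuous)).pow 2) fun t => ?_
      have := one_le_one_add_mul_fluxWeight p (ε := 1 / ((n : ℝ) + 1)) (by positivity) t
      positivity
    exact (hc.comp_aestronglyMeasurable hum).mul
      ((hφ.1.continuous.pow 2).aestronglyMeasurable.mul (hF.measurable_sq.comp_aemeasurable
        hGm.aemeasurable).aestronglyMeasurable)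
  · rw [Real.norm_of_nonneg (by positivity)]
    exact mul_le_mul_of_nonneg_right (logistic_sq_div_le p (by positivity) _) (by positivity)
  · have h1 : Tendsto (fun n : ℕ => logistic p (u x) ^ 2 /
        (1 + 1 / ((n : ℝ) + 1) * fluxWeight p (u x)) ^ 2) atTop
        (𝓝 (logistic p (u x) ^ 2 / (1 + 0 * fluxWeight p (u x)) ^ 2)) :=
      Tendsto.div tendsto_const_nhds
        (((tendsto_one_div_add_atTop_nhds_zero_nat.mul_const _).const_add 1).pow 2) (by simp)
    simpa using h1.mul_const (φ x ^ 2 * F (G x) ^ 2)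

/-- The stability inequality, tested with `softplus p u * φ`. -/
theorem integral_softplus_sq_mul_le (hF : IsFinslerNorm F) (hN : 2 ≤ N) (hp : 0 < p) {δ : ℝ}
    (hδ : 0 < δ) :
    ∃ C, 0 < C ∧ ∀ {u : Euc N → ℝ} {G : Euc N → Euc N} {g : Euc N → ℝ},
      IsH1LocWithGradient u G → LocallyIntegrable g → (∀ x, 0 ≤ g x) →
      (∀ φ : Euc N → ℝ, IsTestFunction φ →
        0 ≤ ∫ x, (energyHessianExt F (G x) (gradient φ x) - g x * φ x ^ 2)) →
      ∀ {φ : Euc N → ℝ}, IsTestFunction φ →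
      Integrable (fun x => g x * (softplus p (u x) * φ x) ^ 2) ∧
      ∫ x, g x * (softplus p (u x) * φ x) ^ 2 ≤
        (1 + δ) * (p ^ 2 / 4) * (∫ x, logistic p (u x) ^ 2 * (φ x ^ 2 * F (G x) ^ 2)) +
        C * ∫ x, softplus p (u x) ^ 2 * ‖gradient φ x‖ ^ 2 := by
  obtain ⟨C, hC, hCb⟩ := hF.exists_abs_mul_fderiv_le
  obtain ⟨B, hB, hBb⟩ := hF.exists_abs_energyHessianExt_le hN
  refine ⟨C ^ 2 / δ + B, by positivity, fun {u G g} hu hg hg0 hs {φ} hφ => ?_⟩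
  have hX := integrable_logistic_sq_mul hF hu hφ (w := fun t => logistic p t ^ 2)
    ((contDiff_logistic p).continuous.pow 2)
    fun t => by
      rw [abs_of_nonneg (sq_nonneg _)]
      exact pow_le_one₀ (logistic_pos p t).le (logistic_le_one p t)
  have hZ := integrable_softplus_sq_mul hu hp.le hφ
  have hd : ∀ t, deriv (softplus p) t = p / 2 * logistic p t := fun t =>
    (hasDerivAt_softplus p t).deriv
  obtain ⟨hY, hS⟩ := stability_comp_mul hF hN hu hg hg0 hs (contDiff_softplus p) (M := 1 + p / 2)
    (fun t => by rw [abs_of_pos (softplus_pos p t)]; exact softplus_le hp.le t)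
    (fun t => by
      have h1 := logistic_le_one p t
      have h2 := logistic_pos p t
      rw [hd, abs_of_pos (by positivity)]
      nlinarith) hφ
  refine ⟨hY, hS.trans ?_⟩
  simp only [hd]
  have hb : ∀ x, energyHessianExt F (G x)
      ((p / 2 * logistic p (u x) * φ x) • G x + softplus p (u x) • gradient φ x) ≤
      (1 + δ) * (p ^ 2 / 4) * (logistic p (u x) ^ 2 * (φ x ^ 2 * F (G x) ^ 2)) +
        (C ^ 2 / δ + B) * (softplus p (u x) ^ 2 * ‖gradient φ x‖ ^ 2) := by
    intro x
    have h4 := softplus_pos p (u x)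
    have hBx : energyHessianExt F (G x) (softplus p (u x) • gradient φ x) ≤
        B * (softplus p (u x) ^ 2 * ‖gradient φ x‖ ^ 2) := by
      refine (le_abs_self _).trans ((hBb _ _).trans_eq ?_)
      rw [norm_smul, mul_pow, Real.norm_of_nonneg h4.le]
    -- Where the gradient vanishes the radial part is absent, and the crude bound on the extended
    -- form is enough.
    by_cases hx : G x = 0
    · rw [hx] at hBx ⊢
      rw [smul_zero, zero_add, hF.map_zero]
      refine hBx.trans ?_
      have : 0 ≤ C ^ 2 / δ * (softplus p (u x) ^ 2 * ‖gradient φ x‖ ^ 2) := by positivity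
      linarith
    · have e : ∀ V, energyHessianExt F (G x) V = energyHessian F (G x) V := fun V => by
        rw [energyHessianExt, if_neg hx]
      rw [e] at hBx ⊢
      rw [hF.energyHessian_smul_self_add hx, map_smul, smul_eq_mul]
      have h2 := abs_cross_le (A := |p / 2 * logistic p (u x) * φ x| * F (G x))
        (B := softplus p (u x) * ‖gradient φ x‖) (C := C) hδ
      rw [mul_pow, mul_pow, sq_abs] at h2
      have h3 : 2 * (p / 2 * logistic p (u x) * φ x) *
          (F (G x) * (softplus p (u x) * fderiv ℝ F (G x) (gradient φ x))) ≤
          2 * C * (|p / 2 * logistic p (u x) * φ x| * F (G x)) *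
            (softplus p (u x) * ‖gradient φ x‖) := by
        calc _ ≤ |2 * (p / 2 * logistic p (u x) * φ x) *
              (F (G x) * (softplus p (u x) * fderiv ℝ F (G x) (gradient φ x)))| := le_abs_self _
          _ = 2 * |p / 2 * logistic p (u x) * φ x| * softplus p (u x) *
              |F (G x) * fderiv ℝ F (G x) (gradient φ x)| := by
              rw [mul_left_comm (F (G x)), abs_mul, abs_mul, abs_mul (softplus p (u x)),
                abs_of_pos h4, abs_of_pos (zero_lt_two (α := ℝ))]
              ring
          _ ≤ 2 * |p / 2 * logistic p (u x) * φ x| * softplus p (u x) *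
              (C * (F (G x) * ‖gradient φ x‖)) :=
              mul_le_mul_of_nonneg_left (hCb _ _) (by positivity)
          _ = _ := by ring
      linarith
  have hRi := (hX.const_mul ((1 + δ) * (p ^ 2 / 4))).add (hZ.const_mul (C ^ 2 / δ + B))
  rw [← integral_const_mul, ← integral_const_mul, ← integral_add (hX.const_mul _) (hZ.const_mul _)]
  -- If the form were not integrable its Bochner integral would be `0`, below the nonnegative right
  -- side.
  by_cases hi : Integrable fun x => energyHessianExt F (G x)
      ((p / 2 * logistic p (u x) * φ x) • G x + softplus p (u x) • gradient φ x)
  · exact integral_mono hi hRi hb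
  · rw [integral_undef hi]
    exact integral_nonneg fun x => by positivity

/-- The energy estimate for stable solutions. -/
theorem exists_energy_estimate (hF : IsFinslerNorm F) (hN : 2 ≤ N) (hp : 0 < p) (hp4 : p < 4) :
    ∃ C, 0 < C ∧ ∀ {u : Euc N → ℝ} {G : Euc N → Euc N} {g : Euc N → ℝ},
      IsH1LocWithGradient u G → LocallyIntegrable g → (∀ x, 0 ≤ g x) →
      (∀ φ : Euc N → ℝ, IsTestFunction φ →
        ∫ x, F (G x) * fderiv ℝ F (G x) (gradient φ x) = ∫ x, g x * φ x) →
      (∀ φ : Euc N → ℝ, IsTestFunction φ →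
        0 ≤ ∫ x, (energyHessianExt F (G x) (gradient φ x) - g x * φ x ^ 2)) →
      ∀ {φ : Euc N → ℝ}, IsTestFunction φ →
      Integrable (fun x => g x * (softplus p (u x) * φ x) ^ 2) ∧
      ∫ x, g x * (softplus p (u x) * φ x) ^ 2 ≤
        C * ∫ x, softplus p (u x) ^ 2 * ‖gradient φ x‖ ^ 2 := by
  -- Chosen so that `p - p²/4 = 10 δ`. The losses `δ + δ p²/4` are at most `5 δ` as `p < 4`, leaving
  -- a margin of `5 δ` for the absorption.
  set δ : ℝ := p * (4 - p) / 40 with hδ_def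
  have h4p : 0 < 4 - p := by linarith
  have hδ : 0 < δ := by positivity
  obtain ⟨C₁, hC₁, h₁⟩ := integral_logistic_sq_mul_le hF hp hδ
  obtain ⟨C₂, hC₂, h₂⟩ := integral_softplus_sq_mul_le hF hN hp hδ
  refine ⟨(1 + δ) * (p ^ 2 / 4) * ((C₁ + C₂) / (5 * δ)) + C₂, by positivity,
    fun {u G g} hu hg hg0 hw hs {φ} hφ => ?_⟩
  obtain ⟨hY, hS⟩ := h₂ hu hg hg0 hs hφ
  have hW := h₁ hu hg hg0 hw hφ hY
  refine ⟨hY, hS.trans ?_⟩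
  set X := ∫ x, logistic p (u x) ^ 2 * (φ x ^ 2 * F (G x) ^ 2)
  set Z := ∫ x, softplus p (u x) ^ 2 * ‖gradient φ x‖ ^ 2
  have hX : 0 ≤ X := integral_nonneg fun x => by positivity
  have h5 : 5 * δ * X ≤ (C₁ + C₂) * Z := by
    have h6 : 5 * δ ≤ p - δ - (1 + δ) * (p ^ 2 / 4) := by
      have : p ^ 2 ≤ 16 := by nlinarith
      have e : p - p ^ 2 / 4 = 10 * δ := by rw [hδ_def]; ring
      nlinarith
    nlinarith [mul_le_mul_of_nonneg_right h6 hX]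
  have h7 : X ≤ (C₁ + C₂) / (5 * δ) * Z := by
    rw [div_mul_eq_mul_div, le_div_iff₀ (by positivity)]
    linarith
  have h8 := mul_le_mul_of_nonneg_left h7 (by positivity : 0 ≤ (1 + δ) * (p ^ 2 / 4))
  linarith

end EnergyEstimate

/-! ### Spatial cutoffs. -/

section Cutoff

variable {N : ℕ}

/-- Smooth cutoff functions at scale `R`. -/
theorem exists_cutoff (N : ℕ) : ∃ K : ℝ, 0 < K ∧ ∀ R : ℝ, 0 < R → ∃ χ : Euc N → ℝ,
    IsTestFunction χ ∧ (∀ x, 0 ≤ χ x ∧ χ x ≤ 1) ∧ (∀ x, ‖x‖ ≤ R → χ x = 1) ∧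
    (∀ x, ‖gradient χ x‖ ≤ K / R) ∧
    ∀ x, gradient χ x ≠ 0 → R ≤ ‖x‖ ∧ ‖x‖ ≤ 2 * R := by
  let β : ContDiffBump (0 : Euc N) := ⟨1, 2, one_pos, one_lt_two⟩
  have hβ : IsTestFunction β := ⟨β.contDiff, β.hasCompactSupport⟩
  obtain ⟨_, K, hK, hb⟩ := hβ.exists_bounds
  refine ⟨K + 1, by positivity, fun R hR => ⟨fun x => β (R⁻¹ • x), ⟨?_, ?_⟩,
    fun x => ⟨β.nonneg, β.le_one⟩, fun x hx => ?_, fun x => ?_, fun x hx => ?_⟩⟩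
  · exact hβ.1.comp (contDiff_const_smul _)
  · exact hβ.2.comp_homeomorph (Homeomorph.smulOfNeZero R⁻¹ (inv_ne_zero hR.ne'))
  · refine β.one_of_mem_closedBall ?_
    rw [mem_closedBall_zero_iff, norm_smul, norm_inv, Real.norm_of_nonneg hR.le,
      inv_mul_le_iff₀ hR]
    simpa [β] using hx
  all_goals
    have hg : gradient (fun x => β (R⁻¹ • x)) x = R⁻¹ • gradient β (R⁻¹ • x) := by
      rw [gradient, fderiv_comp_smul, map_smul, gradient]
  · rw [hg, norm_smul, norm_inv, Real.norm_of_nonneg hR.le, inv_mul_eq_div]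
    exact div_le_div_of_nonneg_right ((hb _).2.1.trans (by linarith)) hR.le
  · have hn : ‖R⁻¹ • x‖ = R⁻¹ * ‖x‖ := by
      rw [norm_smul, norm_inv, Real.norm_of_nonneg hR.le]
    rw [hg] at hx
    have hx' : gradient β (R⁻¹ • x) ≠ 0 := fun h => hx (by rw [h, smul_zero])
    constructor
    · by_contra! h
      refine hx' ?_
      have hmem : R⁻¹ • x ∈ Metric.ball (0 : Euc N) β.rIn := by
        rw [mem_ball_zero_iff, hn, inv_mul_lt_iff₀ hR]
        simpa [β] using h
      have h1 := (β.eventuallyEq_one_of_mem_ball hmem).fderiv_eq (𝕜 := ℝ)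
      rw [gradient, h1]
      simp
    · by_contra! h
      refine hx' (gradient_eq_zero_of_notMem_tsupport ?_)
      rw [β.tsupport_eq, mem_closedBall_zero_iff, hn, not_le, lt_inv_mul_iff₀ hR]
      simpa [β, mul_comm] using h

/-- The fifth power of the cutoff leaves `χ^8` in `|∇φ|²` against `χ^10` in `φ²`, as the absorption
with exponents up to `4` requires. -/
theorem gradient_pow_four_mul {χ : Euc N → ℝ} (hχ : IsTestFunction χ) (x : Euc N) :
    gradient (fun x => χ x ^ 4 * χ x) x = (5 * χ x ^ 4) • gradient χ x := by
  rw [gradient_comp_mul (κ := fun t => t ^ 4) hχ.1 (contDiff_id.pow 4) hχ.1 x, ← add_smul]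
  simp only [deriv_pow_field]
  congr 1
  push_cast
  ring

end Cutoff

/-! ### Absorption and decay of the weighted energy. -/

/-- Young's inequality in the form used to absorb the right-hand side of the energy estimate. -/
theorem absorb_le {p k W E z χ : ℝ} (hp : 0 < p) (hp4 : p ≤ 4) (hk : 0 < k) (hW : 0 < W)
    (hE : 0 < E) (hz : z ^ 2 ≤ E ^ p) (hχ : 0 ≤ χ) (hχ1 : χ ≤ 1) :
    k * (z ^ 2 * χ ^ 8) ≤ 1 / 2 * (W * E * (z * (χ ^ 4 * χ)) ^ 2) + k * (2 * k / W) ^ p := by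
  -- Either the left side is absorbed pointwise, or `E χ² ≤ 2k/W`. In the second case `z² χ^8 ≤ (E
  -- χ²)^p`, where `χ^8 ≤ (χ²)^p` uses `p ≤ 4` and `χ ≤ 1`.
  by_cases h : k ≤ 1 / 2 * (W * E * χ ^ 2)
  · have h1 := mul_le_mul_of_nonneg_right h (by positivity : 0 ≤ z ^ 2 * χ ^ 8)
    have h2 : 0 ≤ k * (2 * k / W) ^ p := by positivity
    nlinarith
  · have h1 : E * χ ^ 2 ≤ 2 * k / W := by
      rw [le_div_iff₀ hW]
      linarith [not_le.1 h]
    have h2 : χ ^ 8 ≤ (χ ^ 2) ^ p := by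
      have := Real.rpow_le_rpow_of_exponent_ge' (sq_nonneg χ) (pow_le_one₀ hχ hχ1) hp.le hp4
      calc χ ^ 8 = (χ ^ 2) ^ (4 : ℕ) := by ring
        _ = (χ ^ 2) ^ (4 : ℝ) := (Real.rpow_ofNat (χ ^ 2) 4).symm
        _ ≤ _ := this
    have h3 : z ^ 2 * χ ^ 8 ≤ (2 * k / W) ^ p := by
      calc z ^ 2 * χ ^ 8 ≤ E ^ p * (χ ^ 2) ^ p := by gcongr
        _ = (E * χ ^ 2) ^ p := (Real.mul_rpow hE.le (sq_nonneg χ)).symm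
        _ ≤ _ := Real.rpow_le_rpow (by positivity) h1 hp.le
    have h4 := mul_le_mul_of_nonneg_left h3 hk.le
    have h5 : 0 ≤ 1 / 2 * (W * E * (z * (χ ^ 4 * χ)) ^ 2) := by positivity
    linarith

/-- The minimum covers both signs of `α`, for which the smallest value of `s ^ α` is at opposite
ends of the interval. -/
theorem rpow_lower_bound {c C : ℝ} (hc : 0 < c) (hcC : c ≤ C) (α : ℝ) : ∃ m : ℝ, 0 < m ∧
    ∀ R s : ℝ, 0 < R → c * R ≤ s → s ≤ C * R → m * R ^ α ≤ s ^ α := by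
  have hC : 0 < C := hc.trans_le hcC
  refine ⟨min (c ^ α) (C ^ α), lt_min (by positivity) (by positivity), fun R s hR h1 h2 => ?_⟩
  have hs : 0 < s := (mul_pos hc hR).trans_le h1
  rcases le_total 0 α with hα | hα
  · calc min (c ^ α) (C ^ α) * R ^ α ≤ c ^ α * R ^ α := by gcongr; exact min_le_left _ _
      _ = (c * R) ^ α := (Real.mul_rpow hc.le hR.le).symm
      _ ≤ s ^ α := Real.rpow_le_rpow (by positivity) h1 hα
  · calc min (c ^ α) (C ^ α) * R ^ α ≤ C ^ α * R ^ α := by gcongr; exact min_le_right _ _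
      _ = (C * R) ^ α := (Real.mul_rpow hC.le hR.le).symm
      _ ≤ s ^ α := Real.rpow_le_rpow_of_nonpos hs h2 hα

/-- Decay of the weighted energy on balls of radius `R`. -/
theorem exists_decay_estimate {N : ℕ} {F : Euc N → ℝ} (hF : IsFinslerNorm F) (hN : 2 ≤ N)
    {α p : ℝ} (hp : 0 < p) (hp4 : p < 4) {u : Euc N → ℝ} {G : Euc N → Euc N}
    (hu : IsH1LocWithGradient u G)
    (hg : LocallyIntegrable fun x => supportFn F x ^ α * Real.exp (u x))
    (hw : ∀ φ : Euc N → ℝ, IsTestFunction φ →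
      ∫ x, F (G x) * fderiv ℝ F (G x) (gradient φ x) =
        ∫ x, supportFn F x ^ α * Real.exp (u x) * φ x)
    (hs : ∀ φ : Euc N → ℝ, IsTestFunction φ →
      0 ≤ ∫ x, (energyHessianExt F (G x) (gradient φ x) -
        supportFn F x ^ α * Real.exp (u x) * φ x ^ 2)) :
    ∃ D : ℝ, ∀ R : ℝ, 0 < R →
      IntegrableOn (fun x => supportFn F x ^ α * Real.exp (u x) * softplus p (u x) ^ 2)
        (Metric.closedBall 0 R) ∧
      ∫ x in Metric.closedBall 0 R, supportFn F x ^ α * Real.exp (u x) * softplus p (u x) ^ 2 ≤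
        D * R ^ ((N : ℝ) - 2 - (2 + α) * p) := by
  obtain ⟨c, C, hc, hcC, hF0⟩ := hF.exists_supportFn_bounds
  have hF0nn : ∀ x, 0 ≤ supportFn F x := fun x => (by positivity : 0 ≤ c * ‖x‖).trans (hF0 x).1
  have hg0 : ∀ x, 0 ≤ supportFn F x ^ α * Real.exp (u x) := fun x =>
    mul_nonneg (Real.rpow_nonneg (hF0nn x) α) (Real.exp_pos _).le
  obtain ⟨A, hA, hE⟩ := exists_energy_estimate hF hN hp hp4
  obtain ⟨K, hK, hcut⟩ := exists_cutoff N
  obtain ⟨m, hm, hmR⟩ := rpow_lower_bound hc (by linarith : c ≤ 2 * C) α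
  set k₀ : ℝ := 25 * A * K ^ 2 with hk₀_def
  have hk₀ : 0 < k₀ := by positivity
  set B : ℝ := k₀ * (2 * k₀ / m) ^ p with hB_def
  have hB : 0 < B := by positivity
  set V : ℝ := volume.real (Metric.closedBall (0 : Euc N) 1) with hV
  -- The factor `2` comes from absorbing half of the energy, and `2 ^ N * V` from the volume of the
  -- ball of radius `2R`.
  refine ⟨2 * (B * (2 ^ N * V)), fun R hR => ?_⟩
  obtain ⟨χ, hχ, hχ01, hχ1, hχb, hχs⟩ := hcut R hR
  have hφ : IsTestFunction fun x => χ x ^ 4 * χ x :=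
    hχ.comp_mul (κ := fun t => t ^ 4) (contDiff_id.pow 4) hχ.1
  obtain ⟨hYi, hY⟩ := hE hu hg hg0 hw hs hφ
  have hZi := integrable_softplus_sq_mul hu hp.le hφ
  have hYball : ∀ x ∈ Metric.closedBall (0 : Euc N) R,
      supportFn F x ^ α * Real.exp (u x) * (softplus p (u x) * (χ x ^ 4 * χ x)) ^ 2 =
        supportFn F x ^ α * Real.exp (u x) * softplus p (u x) ^ 2 := fun x hx => by
    rw [hχ1 x (by simpa using hx)]
    ring
  refine ⟨hYi.integrableOn.congr_fun hYball Metric.isClosed_closedBall.measurableSet, ?_⟩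
  rw [← setIntegral_congr_fun Metric.isClosed_closedBall.measurableSet hYball]
  refine (setIntegral_le_integral hYi
    (Eventually.of_forall fun x => mul_nonneg (hg0 x) (sq_nonneg _))).trans ?_
  set Y := ∫ x, supportFn F x ^ α * Real.exp (u x) * (softplus p (u x) * (χ x ^ 4 * χ x)) ^ 2
  set b : ℝ := B * (R ^ (-2 - (2 + α) * p)) with hb_def
  have hb : 0 < b := by positivity
  have hpt : ∀ x, A * (softplus p (u x) ^ 2 * ‖gradient (fun x => χ x ^ 4 * χ x) x‖ ^ 2) ≤
      1 / 2 * (supportFn F x ^ α * Real.exp (u x) * (softplus p (u x) * (χ x ^ 4 * χ x)) ^ 2) +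
        (Metric.closedBall (0 : Euc N) (2 * R)).indicator (fun _ => b) x := by
    intro x
    have hYx := mul_nonneg (hg0 x) (sq_nonneg (softplus p (u x) * (χ x ^ 4 * χ x)))
    rw [gradient_pow_four_mul hχ]
    by_cases hx : gradient χ x = 0
    · rw [hx, smul_zero, norm_zero]
      have : 0 ≤ (Metric.closedBall (0 : Euc N) (2 * R)).indicator (fun _ => b) x :=
        Set.indicator_nonneg (fun _ _ => hb.le) x
      nlinarith
    · obtain ⟨hx1, hx2⟩ := hχs x hx
      rw [Set.indicator_of_mem (by simpa using hx2)]
      have hW := hmR R (supportFn F x) hR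
        ((mul_le_mul_of_nonneg_left hx1 hc.le).trans (hF0 x).1)
        ((hF0 x).2.trans (by nlinarith))
      have hW0 : 0 < m * R ^ α := by positivity
      have hz : softplus p (u x) ^ 2 ≤ Real.exp (u x) ^ p := by
        calc softplus p (u x) ^ 2 ≤ Real.exp (p / 2 * u x) ^ 2 :=
              pow_le_pow_left₀ (softplus_pos p _).le (softplus_le_exp p _) 2
          _ = Real.exp (u x) ^ p := by
              rw [← Real.exp_mul, ← Real.exp_nat_mul]
              congr 1
              push_cast
              ring
      have hab := absorb_le (k := k₀ * R ^ (-2 : ℝ)) hp hp4.le (by positivity) (hW0.trans_le hW)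
        (Real.exp_pos (u x)) hz (hχ01 x).1 (hχ01 x).2
      have hR2 : R ^ (-2 : ℝ) = (R ^ 2)⁻¹ := by
        rw [Real.rpow_neg hR.le]
        norm_num
      have e1 : A * (softplus p (u x) ^ 2 * ‖(5 * χ x ^ 4) • gradient χ x‖ ^ 2) ≤
          k₀ * R ^ (-2 : ℝ) * (softplus p (u x) ^ 2 * χ x ^ 8) := by
        have h0 := (hχ01 x).1
        rw [norm_smul, Real.norm_of_nonneg (by positivity)]
        have h1 := pow_le_pow_left₀ (norm_nonneg _) (hχb x) 2
        calc A * (softplus p (u x) ^ 2 * (5 * χ x ^ 4 * ‖gradient χ x‖) ^ 2)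
            = 25 * A * (softplus p (u x) ^ 2 * χ x ^ 8) * ‖gradient χ x‖ ^ 2 := by ring
          _ ≤ 25 * A * (softplus p (u x) ^ 2 * χ x ^ 8) * (K / R) ^ 2 := by gcongr
          _ = _ := by rw [hR2, hk₀_def]; ring
      -- On the annulus carrying `∇χ` the weight is at least `m R^α`, so `k (2k/W)^p` with `k = k₀
      -- R^{-2}` scales like `R^{-2-(2+α)p}`.
      have e2 : k₀ * R ^ (-2 : ℝ) * (2 * (k₀ * R ^ (-2 : ℝ)) / supportFn F x ^ α) ^ p ≤ b := by
        calc k₀ * R ^ (-2 : ℝ) * (2 * (k₀ * R ^ (-2 : ℝ)) / supportFn F x ^ α) ^ p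
            ≤ k₀ * R ^ (-2 : ℝ) * (2 * (k₀ * R ^ (-2 : ℝ)) / (m * R ^ α)) ^ p :=
              mul_le_mul_of_nonneg_left (Real.rpow_le_rpow
                (div_nonneg (by positivity) (hW0.trans_le hW).le)
                (div_le_div_of_nonneg_left (by positivity) hW0 hW) hp.le) (by positivity)
          _ = k₀ * R ^ (-2 : ℝ) * ((2 * k₀ / m) * R ^ (-2 - α)) ^ p := by
              rw [Real.rpow_sub hR]
              congr 2
              field_simp
          _ = b := by
              rw [Real.mul_rpow (by positivity) (by positivity), ← Real.rpow_mul hR.le, hb_def,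
                hB_def, (by ring : -2 - (2 + α) * p = -2 + (-2 - α) * p), Real.rpow_add hR]
              ring
      linarith
  have hind : Integrable ((Metric.closedBall (0 : Euc N) (2 * R)).indicator fun _ => b) := by
    rw [integrable_indicator_iff Metric.isClosed_closedBall.measurableSet]
    exact integrableOn_const (isCompact_closedBall _ _).measure_lt_top.ne
  have hint := integral_mono (hZi.const_mul A) ((hYi.const_mul (1 / 2)).add hind) hpt
  simp only [Pi.add_apply] at hint
  rw [integral_const_mul, integral_add (hYi.const_mul (1 / 2)) hind, integral_const_mul,
    integral_indicator Metric.isClosed_closedBall.measurableSet, setIntegral_const,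
    smul_eq_mul] at hint
  have hvol : volume.real (Metric.closedBall (0 : Euc N) (2 * R)) = (2 * R) ^ N * V := by
    rw [hV, Measure.addHaar_real_closedBall' volume 0 (by positivity), finrank_euclideanSpace_fin]
  rw [hvol] at hint
  have hRR : R ^ ((N : ℝ) - 2 - (2 + α) * p) = R ^ N * R ^ (-2 - (2 + α) * p) := by
    rw [(by ring : (N : ℝ) - 2 - (2 + α) * p = N + (-2 - (2 + α) * p)), Real.rpow_add hR,
      Real.rpow_natCast]
  rw [hRR]
  have e3 : (2 * R) ^ N * V * b = B * (2 ^ N * V) * (R ^ N * R ^ (-2 - (2 + α) * p)) := by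
    rw [hb_def, mul_pow]
    ring
  rw [e3] at hint
  linarith

/-! ### Nonexistence. -/

theorem theorem1p5 (N : ℕ) (α : ℝ) (hα : -2 < α) (hN : 2 ≤ N) (hNα : (N : ℝ) < 10 + 4 * α)
    (F : Euc N → ℝ) (hF : IsFinslerNorm F) :
    ¬ ∃ u : Euc N → ℝ,
      IsWeakStableSolution F (fun x t => supportFn F x ^ α * Real.exp t) u := by
  rintro ⟨u, G, ⟨hu, hg, hw⟩, hs⟩
  have : Nonempty (Fin N) := ⟨⟨0, by lia⟩⟩
  have hα2 : 0 < 2 + α := by linarith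
  have hN2 : (2 : ℝ) ≤ N := by exact_mod_cast hN
  obtain ⟨p, hp1, hp4⟩ : ∃ p : ℝ, ((N : ℝ) - 2) / (2 + α) < p ∧ p < 4 := by
    refine exists_between ?_
    rw [div_lt_iff₀ hα2]
    linarith
  have hp : 0 < p := (div_nonneg (by linarith) hα2.le).trans_lt hp1
  rw [div_lt_iff₀ hα2] at hp1
  simp only [IsStable, deriv_const_mul_field, Real.deriv_exp] at hs
  obtain ⟨D, hD⟩ := exists_decay_estimate hF hN hp hp4 hu hg hw hs
  obtain ⟨c, C, hc, -, hF0⟩ := hF.exists_supportFn_bounds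
  set h : Euc N → ℝ := fun x => supportFn F x ^ α * Real.exp (u x) * softplus p (u x) ^ 2 with hh
  have hF0nn : ∀ x, 0 ≤ supportFn F x := fun x => (by positivity : 0 ≤ c * ‖x‖).trans (hF0 x).1
  have hnn : ∀ x, 0 ≤ h x := fun x =>
    mul_nonneg (mul_nonneg (Real.rpow_nonneg (hF0nn x) α) (Real.exp_pos _).le) (sq_nonneg _)
  have hpos : 0 < ∫ x in Metric.closedBall 0 1, h x := by
    rw [setIntegral_pos_iff_support_of_nonneg_ae (Eventually.of_forall hnn) (hD 1 one_pos).1]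
    -- The origin is removed because `F⁰` vanishes there and its power may take a default value; a
    -- point is null.
    have hsub : Metric.closedBall (0 : Euc N) 1 \ {0} ⊆
        Function.support h ∩ Metric.closedBall 0 1 := by
      rintro x ⟨hx, hx0⟩
      refine ⟨?_, hx⟩
      have h1 : 0 < supportFn F x := (mul_pos hc (norm_pos_iff.2 hx0)).trans_le (hF0 x).1
      have h2 := softplus_pos p (u x)
      have : 0 < h x := by positivity
      exact this.ne'
    refine lt_of_lt_of_le ?_ (measure_mono hsub)
    rw [measure_sdiff_null (measure_singleton 0)]
    exact Metric.measure_closedBall_pos volume 0 one_pos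
  -- The energy on the unit ball is fixed and positive, but is dominated by that on every larger
  -- ball, whose bound decays.
  have hle : ∀ᶠ R : ℝ in atTop, ∫ x in Metric.closedBall 0 1, h x ≤
      D * R ^ (-((2 + α) * p - (N - 2))) := by
    filter_upwards [eventually_ge_atTop 1] with R hR
    have hR0 : 0 < R := by linarith
    have h1 := setIntegral_mono_set (hD R hR0).1 (Eventually.of_forall hnn)
      (Metric.closedBall_subset_closedBall (x := (0 : Euc N)) hR).eventuallyLE
    refine h1.trans ((hD R hR0).2.trans_eq ?_)
    congr 2
    ring
  have hlim := (tendsto_rpow_neg_atTop (y := (2 + α) * p - (N - 2)) (by linarith)).const_mul D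
  rw [mul_zero] at hlim
  exact absurd (ge_of_tendsto hlim hle) (not_le.2 hpos)
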